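/- There are infinite trees $T$ and $S$ of maximum degree three, neither of which embeds into the other, with the following properties. (1) There is a bijection $\varphi\colon V(T)\to V(S)$ that is a (vertex-)hypomorphism, i.e. $T-x\cong S-\varphi(x)$ for every $x\in V(T)$. (2) $T$ is the union of an increasing chain $T_0\subseteq T_1\subseteq\cdots$ of rooted subtrees, where each $T_n$ is an induced subgraph and an order-preserving subtree of $T_{n+1}$ (the path from any vertex of $T_n$ to the root of $T_{n+1}$ passes through the root of $T_n$), and every vertex of $T$ is a non-root vertex of some $T_n$; likewise $S=\bigcup_n S_n$. For a vertex $x$ of $T$, let $e(x)$ be the first edge on the path from $x$ to the root of $T_n$, where $T_n$ is any member of the chain in which $x$ is a non-root vertex (the edge does not depend on $n$); define $e(y)$ for $y\in V(S)$ in the same way. Then $x\mapsto e(x)$ and $y\mapsto e(y)$ are bijections $V(T)\to E(T)$ and $V(S)\to E(S)$. (3) The map $\psi\colon e(x)\mapsto e(\varphi(x))$ is a bijection $E(T)\to E(S)$ and an edge-hypomorphism, i.e. $T-e\cong S-\psi(e)$ for every $e\in E(T)$. Indeed, for every $x\in V(T)$ there is an isomorphism $h_x\colon T-x\to S-\varphi(x)$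 such that $h_x\cup\{(x,\varphi(x))\}$ is an isomorphism $T-e(x)\to S-e(\varphi(x))$. Hence $T$ and $S$ are locally finite graphs with infinitely many edges that are not isomorphic but are simultaneously vertex-hypomorphic and edge-hypomorphic. In particular neither $T$ nor $S$ is edge-reconstructible (a graph $G$ is edge-reconstructible if every graph edge-hypomorphic to $G$ is isomorphic to $G$), which answers in the negative Andreae's question whether every locally finite graph with infinitely many edges is edge-reconstructible. -/

import Mathlib

/-- `φ` is a (vertex-)hypomorphism from `G` to `H`: `G - v ≅ H - φ(v)` for every vertex `v`. -/
def IsHypomorphism {V W : Type*} (G : SimpleGraph V) (H : SimpleGraph W) (φ : V ≃ W) : Prop :=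
  ∀ v : V, Nonempty (G.induce {x | x ≠ v} ≃g H.induce {y | y ≠ φ v})

/-- `ψ` is an edge-hypomorphism from `G` to `H`: `G - e ≅ H - ψ(e)` for every edge `e`. -/
def IsEdgeHypomorphism {V W : Type*} (G : SimpleGraph V) (H : SimpleGraph W)
    (ψ : G.edgeSet ≃ H.edgeSet) : Prop :=
  ∀ e : G.edgeSet, Nonempty (G.deleteEdges {e.1} ≃g H.deleteEdges {(ψ e).1})

/-- `G` and `H` are edge-hypomorphic. -/
def EdgeHypomorphic {V W : Type*} (G : SimpleGraph V) (H : SimpleGraph W) : Prop :=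
  ∃ ψ : G.edgeSet ≃ H.edgeSet, IsEdgeHypomorphism G H ψ

/-- `G` is edge-reconstructible: every graph that is edge-hypomorphic to `G` is isomorphic
to `G`. -/
def EdgeReconstructible.{u} {V : Type u} (G : SimpleGraph V) : Prop :=
  ∀ (W : Type u) (H : SimpleGraph W), EdgeHypomorphic G H → Nonempty (H ≃g G)

/-- Every vertex has finite degree. -/
def IsLocallyFinite {V : Type*} (G : SimpleGraph V) : Prop :=
  ∀ v : V, (G.neighborSet v).Finite

/-- The maximum degree of `G` exists and equals `d`. -/
def HasMaxDegree {V : Type*} (G : SimpleGraph V) (d : ℕ) : Prop :=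
  (∀ v : V, (G.neighborSet v).encard ≤ d) ∧ ∃ v : V, (G.neighborSet v).encard = d

/-- `e` is the first edge on a path of `G` from `x` to `r` (in particular, `x ≠ r`). -/
def IsFirstEdge {V : Type*} (G : SimpleGraph V) (x r : V) (e : Sym2 V) : Prop :=
  ∃ p : G.Walk x r, p.IsPath ∧ p.edges.head? = some e

/-- A presentation of the tree `T` as the union of an increasing chain of rooted subtrees
`T₀ ⊆ T₁ ⊆ T₂ ⊆ ⋯` (induced on the vertex sets `part n`, with roots `root n`), each of them an
order-preserving subtree of the next: the path from any vertex of `Tₙ` to the root of `Tₙ₊₁` runs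
through the root of `Tₙ`. No vertex stays a root forever. -/
structure RootedExhaustion {V : Type*} (T : SimpleGraph V) where
  part : ℕ → Set V
  root : ℕ → V
  root_mem : ∀ n, root n ∈ part n
  isTree : ∀ n, (T.induce (part n)).IsTree
  subset_succ : ∀ n, part n ⊆ part (n + 1)
  root_mem_path : ∀ n, ∀ x ∈ part n, ∀ p : T.Walk x (root (n + 1)), p.IsPath →
    root n ∈ p.support
  exists_part : ∀ x, ∃ n, x ∈ part n ∧ x ≠ root n

/-- `e x` is, for every `n` such that `x` is a vertex of `Tₙ` other than its root, the first edge
on the path from `x` to the root of `Tₙ`. When `T` is a tree, this determines `e`. -/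
def RootedExhaustion.IsFirstEdgeMap {V : Type*} {T : SimpleGraph V} (E : RootedExhaustion T)
    (e : V → T.edgeSet) : Prop :=
  ∀ n, ∀ x ∈ E.part n, x ≠ E.root n → IsFirstEdge T x (E.root n) (e x).1

/-! Both trees carry a distinguished end. Every vertex `x` has a parent, every edge joins a unique
`x` to its parent, and the chain of rooted subtrees consists of the descendants of the successive
ancestors of a fixed vertex. So `e(x)` is the edge above `x`, and it suffices to find a bijection
`φ` together with isomorphisms `T - e(x) ≅ S - e(φ(x))` taking `x` to `φ(x)` (`Exchangeable`); away
from `x` these restrict to isomorphisms of vertex-deleted trees. Exchangeability composes and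
inverts, and the trees are countable. Hence it is enough that each vertex of either tree is
exchangeable with infinitely many vertices of the other (`exists_equiv_exchangeable`).

Construction. Call the trees `T^i`, `i : Bool`. Let `T^i_n` be the part below the spine vertex
number `3n`, and `U^i_n` the part reached upwards from there. In step `n` a path, the link, is
attached to the spine vertex number `3(n+1)`. At its near end hang `T^i_n` and the further upward
part of `T^i`; at its far end hang copies of `T^j_n` and of the further upward part of `T^j`, with
`j = !i`. So both trees consist of the same four parts around the same link and differ only in which
upward part continues the spine. One vertex `x` of `T^a_n`, `a = active n`, is then moved: in
`T^(!a)` the copy of `T^a_n` loses the subtree below `x`, which hangs from the link instead.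
Deleting the edge above `x` in `T^a` and the edge above the moved copy in `T^(!a)` leaves isomorphic
forests (`joinEquiv_step`). The schedule moves every vertex infinitely often.

The copied upward parts depend on later steps, so the trees cannot be built as a plain union of
finished pieces. They are unfolded from a transition system (`child`, `run`) whose states name the
parts, and each move is selected among the vertices that the earlier moves already determine.

Non-embedding. Vertices of degree three occur only on links. The link of level `n` has `2n+4` of
them including its ends, and exactly one pendant tree on it, next to a fixed end, is not a single
vertex. An embedding therefore preserves levels and positions on links (`placeOf_map`). The image of
a root of `T^i_(n+1)` on the spine cannot be the far end of a link of the other tree: that would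
either squeeze `T^a_n` into itself with a subtree removed, contradicted by counting the vertices at
one depth, or send a higher link to a lower one (`core_type_map`). Thus the image has the same type
up to cutting, and this persists along the whole spine (`core_type_map_succ`). But upward rays of
the other tree end in its own spine, whose types belong to the other index (`not_isContained`). -/

/-! ### Trees given by a parent function -/

/-- A parent function on `V` all of whose orbits are infinite and eventually merge; it describes
a tree with a distinguished end. -/
structure ParentTree (V : Type*) where
  par : V → V
  ht : V → ℤ
  ht_par : ∀ x, ht (par x) = ht x + 1
  meet : ∀ x y, ∃ k l, par^[k] x = par^[l] y

namespace ParentTree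

variable {V : Type*} (P : ParentTree V)

theorem ht_iterate (k : ℕ) (x : V) : P.ht (P.par^[k] x) = P.ht x + k := by
  induction k generalizing x with
  | zero => simp
  | succ k ih => rw [Function.iterate_succ_apply, ih, P.ht_par]; push_cast; ring

theorem iterate_eq_iff {k l : ℕ} {x : V} : P.par^[k] x = P.par^[l] x ↔ k = l := by
  refine ⟨fun h => ?_, fun h => by rw [h]⟩
  have := congrArg P.ht h
  rw [P.ht_iterate, P.ht_iterate] at this
  omega

theorem par_ne (x : V) : P.par x ≠ x := fun h => by
  have := P.ht_par x; rw [h] at this; omega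

/-- The tree in which every vertex is joined to its parent. -/
def graph : SimpleGraph V where
  Adj x y := P.par x = y ∨ P.par y = x
  symm := ⟨fun _ _ h => h.symm⟩
  loopless := ⟨fun x h => by rcases h with h | h <;> exact P.par_ne x h⟩

theorem adj_iff {x y : V} : P.graph.Adj x y ↔ P.par x = y ∨ P.par y = x := Iff.rfl

theorem adj_par (x : V) : P.graph.Adj x (P.par x) := Or.inl rfl

/-- The descendants of `x`, including `x`. -/
def desc (x : V) : Set V := {y | ∃ k, P.par^[k] y = x}

theorem self_mem_desc (x : V) : x ∈ P.desc x := ⟨0, rfl⟩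

theorem ht_le_of_mem_desc {x y : V} (h : y ∈ P.desc x) : P.ht y ≤ P.ht x := by
  obtain ⟨k, rfl⟩ := h
  rw [P.ht_iterate]; omega

theorem par_notMem_desc (x : V) : P.par x ∉ P.desc x := fun h => by
  have := P.ht_le_of_mem_desc h
  rw [P.ht_par] at this; omega

theorem mem_desc_of_par {x y : V} (h : P.par y ∈ P.desc x) : y ∈ P.desc x := by
  obtain ⟨k, hk⟩ := h
  exact ⟨k + 1, hk⟩

theorem par_mem_desc {x y : V} (h : y ∈ P.desc x) (hne : y ≠ x) : P.par y ∈ P.desc x := by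
  obtain ⟨k, hk⟩ := h
  cases k with
  | zero => exact absurd hk hne
  | succ k => exact ⟨k, hk⟩

/-- The only edge leaving the set of descendants of `x` joins `x` to its parent. -/
theorem eq_of_adj_of_mem_desc {x y z : V} (h : P.graph.Adj y z) (hy : y ∈ P.desc x)
    (hz : z ∉ P.desc x) : y = x ∧ z = P.par x := by
  rcases h with h | h
  · by_cases hyx : y = x
    · exact ⟨hyx, by rw [← h, hyx]⟩
    · exact absurd (h ▸ P.par_mem_desc hy hyx) hz
  · exact absurd (P.mem_desc_of_par (h.symm ▸ hy)) hz

theorem mem_support_of_walk {x y z : V} (p : P.graph.Walk y z) (hy : y ∈ P.desc x)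
    (hz : z ∉ P.desc x) : x ∈ p.support := by
  induction p with
  | nil => exact absurd hy hz
  | @cons u v w h p ih =>
    by_cases hv : v ∈ P.desc x
    · simp [ih hv hz]
    · simp [(P.eq_of_adj_of_mem_desc h hy hv).1]

theorem reachable_iterate (k : ℕ) (x : V) : P.graph.Reachable x (P.par^[k] x) := by
  induction k generalizing x with
  | zero => exact .refl _
  | succ k ih =>
    rw [Function.iterate_succ_apply]
    exact (P.adj_par x).reachable.trans (ih _)

/-- Every edge is a bridge: without the edge above `x`, no walk leaves the descendants of `x`. -/
theorem isAcyclic : P.graph.IsAcyclic := by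
  rw [SimpleGraph.isAcyclic_iff_forall_adj_isBridge]
  have key : ∀ x, P.graph.IsBridge s(x, P.par x) := by
    intro x
    rw [SimpleGraph.isBridge_iff]
    rintro ⟨p⟩
    have hstay : ∀ {u v : V} (q : (P.graph.deleteEdges {s(x, P.par x)}).Walk u v),
        u ∈ P.desc x → v ∈ P.desc x := by
      intro u v q
      induction q with
      | nil => exact id
      | @cons u v w h q ih =>
        intro hu
        apply ih
        by_contra hv
        rw [SimpleGraph.deleteEdges_adj] at h
        have := P.eq_of_adj_of_mem_desc h.1 hu hv
        exact h.2 (by rw [this.1, this.2]; rfl)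
    exact P.par_notMem_desc x (hstay p (P.self_mem_desc x))
  intro v w h
  rcases h with h | h
  · exact h ▸ key v
  · rw [Sym2.eq_swap]; exact h ▸ key w

theorem isTree [Nonempty V] : P.graph.IsTree := by
  refine ⟨⟨fun x y => ?_⟩, P.isAcyclic⟩
  obtain ⟨k, l, h⟩ := P.meet x y
  exact (P.reachable_iterate k x).trans (h ▸ (P.reachable_iterate l y).symm)

theorem isTree_induce_desc (r : V) : (P.graph.induce (P.desc r)).IsTree := by
  have key : ∀ (k : ℕ) (x : V) (hx : P.par^[k] x = r),
      (P.graph.induce (P.desc r)).Reachable ⟨x, k, hx⟩ ⟨r, 0, rfl⟩ := by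
    intro k
    induction k with
    | zero => rintro x rfl; exact .refl _
    | succ k ih =>
      intro x hx
      refine .trans (SimpleGraph.Adj.reachable ?_) (ih (P.par x) hx)
      exact P.adj_par x
  have : Nonempty (P.desc r) := ⟨⟨r, 0, rfl⟩⟩
  refine ⟨⟨?_⟩, P.isAcyclic.induce _⟩
  rintro ⟨x, k, hk⟩ ⟨y, l, hl⟩
  exact (key k x hk).trans (key l y hl).symm

theorem isFirstEdge {k : ℕ} {x r : V} (hk : P.par^[k + 1] x = r) :
    IsFirstEdge P.graph x r s(x, P.par x) := by
  -- The path must be known to run through ancestors only: heights then show that it avoids any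
  -- vertex below its start, so it can be prolonged downwards.
  have key : ∀ (k : ℕ) (x r : V), P.par^[k] x = r → ∃ p : P.graph.Walk x r, p.IsPath ∧
      ∀ y ∈ p.support, ∃ j, y = P.par^[j] x := by
    intro k
    induction k with
    | zero => rintro x r rfl; exact ⟨.nil, by simp, fun y hy => ⟨0, by simpa using hy⟩⟩
    | succ k ih =>
      intro x r hr
      obtain ⟨p, hp, hs⟩ := ih (P.par x) r hr
      refine ⟨.cons (P.adj_par x) p, ?_, ?_⟩
      · rw [SimpleGraph.Walk.cons_isPath_iff]
        refine ⟨hp, fun hx => ?_⟩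
        obtain ⟨j, hj⟩ := hs x hx
        have : P.par^[0] x = P.par^[j + 1] x := hj
        rw [P.iterate_eq_iff] at this
        omega
      · intro y hy
        rw [SimpleGraph.Walk.support_cons, List.mem_cons] at hy
        rcases hy with rfl | hy
        · exact ⟨0, rfl⟩
        · obtain ⟨j, hj⟩ := hs y hy
          exact ⟨j + 1, hj⟩
  obtain ⟨p, hp, hs⟩ := key k (P.par x) r hk
  refine ⟨.cons (P.adj_par x) p, ?_, by simp⟩
  rw [SimpleGraph.Walk.cons_isPath_iff]
  refine ⟨hp, fun hx => ?_⟩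
  obtain ⟨j, hj⟩ := hs x hx
  have : P.par^[0] x = P.par^[j + 1] x := hj
  rw [P.iterate_eq_iff] at this
  omega

/-- The exhaustion of the tree by the sets of descendants of the ancestors of `o`. -/
def exhaustion (o : V) : RootedExhaustion P.graph where
  part n := P.desc (P.par^[n] o)
  root n := P.par^[n] o
  root_mem n := P.self_mem_desc _
  isTree n := P.isTree_induce_desc _
  subset_succ n := by
    rintro x ⟨k, hk⟩
    refine ⟨k + 1, ?_⟩
    rw [Function.iterate_succ_apply', hk, Function.iterate_succ_apply']
  root_mem_path n x hx p _ := by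
    refine P.mem_support_of_walk p hx ?_
    rw [Function.iterate_succ_apply']
    exact P.par_notMem_desc _
  exists_part x := by
    obtain ⟨k, l, h⟩ := P.meet x o
    by_cases hx : x = P.par^[l] o
    · refine ⟨l + 1, ⟨k + 1, ?_⟩, fun h' => ?_⟩
      · rw [Function.iterate_succ_apply', h, Function.iterate_succ_apply']
      · rw [Function.iterate_succ_apply', ← hx] at h'
        exact P.par_ne x h'.symm
    · exact ⟨l, ⟨k, h⟩, hx⟩

/-- The edge from a vertex to its parent. -/
def parEdge (x : V) : P.graph.edgeSet := ⟨s(x, P.par x), P.adj_par x⟩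

theorem isFirstEdgeMap (o : V) : (P.exhaustion o).IsFirstEdgeMap P.parEdge := by
  rintro n x ⟨k, hk⟩ hne
  cases k with
  | zero => exact absurd hk hne
  | succ k => exact P.isFirstEdge hk

theorem parEdge_bijective : Function.Bijective P.parEdge := by
  constructor
  · intro x y h
    have h' : s(x, P.par x) = s(y, P.par y) := congrArg Subtype.val h
    rw [Sym2.eq_iff] at h'
    rcases h' with h' | ⟨h1, h2⟩
    · exact h'.1
    · have a := P.ht_par x
      have b := P.ht_par y
      rw [h2] at a; rw [← h1] at b; omega
  · rintro ⟨e, he⟩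
    induction e with
    | h x y =>
      have h : P.par x = y ∨ P.par y = x := he
      rcases h with rfl | rfl
      · exact ⟨x, rfl⟩
      · exact ⟨y, Subtype.ext Sym2.eq_swap⟩

/-! ### Exchangeable vertices -/

/-- The vertices `x` and `y` are exchangeable if deleting the edges above them produces isomorphic
forests, with `x` corresponding to `y`. -/
def Exchangeable {W : Type*} (P : ParentTree V) (Q : ParentTree W) (x : V) (y : W) : Prop :=
  ∃ g : P.graph.deleteEdges {(P.parEdge x).1} ≃g Q.graph.deleteEdges {(Q.parEdge y).1}, g x = y

theorem Exchangeable.symm {W : Type*} {P : ParentTree V} {Q : ParentTree W} {x : V} {y : W}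
    (h : P.Exchangeable Q x y) : Q.Exchangeable P y x := by
  obtain ⟨g, hg⟩ := h
  exact ⟨g.symm, g.injective ((g.apply_symm_apply y).trans hg.symm)⟩

theorem Exchangeable.trans {W U : Type*} {P : ParentTree V} {Q : ParentTree W} {R : ParentTree U}
    {x : V} {y : W} {z : U} (h : P.Exchangeable Q x y) (h' : Q.Exchangeable R y z) :
    P.Exchangeable R x z := by
  obtain ⟨g, hg⟩ := h
  obtain ⟨g', hg'⟩ := h'
  exact ⟨g.trans g', (congrArg g' hg).trans hg'⟩

theorem Exchangeable.refl (P : ParentTree V) (x : V) : P.Exchangeable P x x := ⟨.refl, rfl⟩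

theorem not_adj_deleteEdges {r u v : V} (hu : u ∈ P.desc r) (hv : v ∉ P.desc r) :
    ¬ (P.graph.deleteEdges {(P.parEdge r).1}).Adj u v := fun h => by
  rw [SimpleGraph.deleteEdges_adj] at h
  obtain ⟨rfl, rfl⟩ := P.eq_of_adj_of_mem_desc h.1 hu hv
  exact h.2 rfl

theorem adj_deleteEdges_iff {r u v : V} (h : ¬ (u = r ∧ v = P.par r)) (h' : ¬ (u = P.par r ∧ v = r)) :
    (P.graph.deleteEdges {(P.parEdge r).1}).Adj u v ↔ P.graph.Adj u v := by
  rw [SimpleGraph.deleteEdges_adj, and_iff_left_iff_imp]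
  intro _ hs
  have hs' : s(u, v) = s(r, P.par r) := hs
  rw [Sym2.eq_iff] at hs'
  tauto

theorem adj_deleteEdges_of_mem_iff {r u v : V} (h : u ∈ P.desc r ↔ v ∈ P.desc r) :
    (P.graph.deleteEdges {(P.parEdge r).1}).Adj u v ↔ P.graph.Adj u v := by
  apply P.adj_deleteEdges_iff
  · rintro ⟨rfl, rfl⟩
    exact P.par_notMem_desc _ (h.1 (P.self_mem_desc _))
  · rintro ⟨rfl, rfl⟩
    exact P.par_notMem_desc _ (h.2 (P.self_mem_desc _))

/-- Isomorphisms between the two sides of the edges above `x` and `y` combine. -/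
theorem exchangeable_of_iso {W : Type*} {P : ParentTree V} {Q : ParentTree W} {x : V} {y : W}
    (α : P.graph.induce (P.desc x)ᶜ ≃g Q.graph.induce (Q.desc y)ᶜ)
    (β : P.graph.induce (P.desc x) ≃g Q.graph.induce (Q.desc y))
    (hβ : (β ⟨x, P.self_mem_desc x⟩).1 = y) : P.Exchangeable Q x y := by
  classical
  let g : V ≃ W := (Equiv.Set.sumCompl (P.desc x)).symm.trans
    ((Equiv.sumCongr β.toEquiv α.toEquiv).trans (Equiv.Set.sumCompl (Q.desc y)))
  have g1 : ∀ (z) (hz : z ∈ P.desc x), g z = (β ⟨z, hz⟩).1 := by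
    intro z hz; simp [g, Equiv.Set.sumCompl_symm_apply_of_mem hz]
  have g2 : ∀ (z) (hz : z ∉ P.desc x), g z = (α ⟨z, hz⟩).1 := by
    intro z hz; simp [g, Equiv.Set.sumCompl_symm_apply_of_notMem hz]
  refine ⟨⟨g, ?_⟩, ?_⟩
  · intro u v
    have m1 : ∀ z (hz : z ∈ P.desc x), g z ∈ Q.desc y := fun z hz => by
      rw [g1 z hz]; exact (β _).2
    have m2 : ∀ z (hz : z ∉ P.desc x), g z ∉ Q.desc y := fun z hz => by
      rw [g2 z hz]; exact (α _).2
    by_cases hu : u ∈ P.desc x <;> by_cases hv : v ∈ P.desc x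
    · change (Q.graph.deleteEdges _).Adj (g u) (g v) ↔ _
      rw [P.adj_deleteEdges_of_mem_iff (by simp [hu, hv]),
        Q.adj_deleteEdges_of_mem_iff (iff_of_true (m1 u hu) (m1 v hv)), g1 u hu, g1 v hv]
      exact β.map_adj_iff (v := ⟨u, hu⟩) (w := ⟨v, hv⟩)
    · exact iff_of_false (Q.not_adj_deleteEdges (m1 u hu) (m2 v hv))
        (P.not_adj_deleteEdges hu hv)
    · exact iff_of_false (fun h => Q.not_adj_deleteEdges (m1 v hv) (m2 u hu) h.symm)
        (fun h => P.not_adj_deleteEdges hv hu h.symm)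
    · change (Q.graph.deleteEdges _).Adj (g u) (g v) ↔ _
      rw [P.adj_deleteEdges_of_mem_iff (by simp [hu, hv]),
        Q.adj_deleteEdges_of_mem_iff (iff_of_false (m2 u hu) (m2 v hv)), g2 u hu, g2 v hv]
      exact α.map_adj_iff (v := ⟨u, hu⟩) (w := ⟨v, hv⟩)
  · exact (g1 x (P.self_mem_desc x)).trans hβ

/-- If every vertex of either tree is exchangeable with infinitely many vertices of the other one,
then some bijection matches exchangeable vertices. -/
theorem exists_equiv_exchangeable {V W : Type} [Countable V] [Countable W] {P : ParentTree V}
    {Q : ParentTree W} (h1 : ∀ x, {y | P.Exchangeable Q x y}.Infinite)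
    (h2 : ∀ y, {x | P.Exchangeable Q x y}.Infinite) :
    ∃ φ : V ≃ W, ∀ x, P.Exchangeable Q x (φ x) := by
  classical
  let s : Setoid V := ⟨P.Exchangeable P, ⟨.refl P, .symm, .trans⟩⟩
  have hb : ∀ y, ∃ x, P.Exchangeable Q x y := fun y => (h2 y).nonempty
  choose b hb using hb
  let f : V → Quotient s := Quotient.mk s
  -- A vertex of the second tree is assigned the class of any vertex of the first that it can be
  -- exchanged with. Both fibres over each class are then countably infinite.
  let g : W → Quotient s := fun y => Quotient.mk s (b y)
  have hfg : ∀ x y, f x = g y ↔ P.Exchangeable Q x y := by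
    intro x y
    refine Quotient.eq.trans ⟨fun h => Exchangeable.trans h (hb y), fun h => ?_⟩
    exact Exchangeable.trans h (hb y).symm
  have e : ∀ c, Nonempty ({x // f x = c} ≃ {y // g y = c}) := by
    intro c
    obtain ⟨x, rfl⟩ := Quotient.exists_rep c
    have i2 : Infinite {y // g y = f x} := by
      have := h1 x
      rw [show {y | P.Exchangeable Q x y} = {y | g y = f x} from
        Set.ext fun y => by rw [Set.mem_ofPred_eq, ← hfg, eq_comm]; rfl] at this
      exact this.to_subtype
    obtain ⟨y, hy⟩ := (h1 x).nonempty
    have i1 : Infinite {x' // f x' = f x} := by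
      have := h2 y
      rw [show {x | P.Exchangeable Q x y} = {x' | f x' = f x} from
        Set.ext fun x' => by
          rw [Set.mem_ofPred_eq, Set.mem_ofPred_eq, ← hfg, (hfg x y).2 hy]] at this
      exact this.to_subtype
    exact nonempty_equiv_of_countable
  refine ⟨Equiv.ofFiberEquiv fun c => (e c).some, fun x => ?_⟩
  rw [← hfg]
  exact (Equiv.ofFiberEquiv_map _ x).symm

/-- The deleted edges are incident with `x` and `y`, so they are invisible once these corresponding
vertices are removed as well. -/
theorem exists_induce_iso {W : Type*} {P : ParentTree V} {Q : ParentTree W} {x : V} {y : W}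
    (g : P.graph.deleteEdges {(P.parEdge x).1} ≃g Q.graph.deleteEdges {(Q.parEdge y).1})
    (hg : g x = y) :
    ∃ h : P.graph.induce {z | z ≠ x} ≃g Q.graph.induce {z | z ≠ y},
      ∀ (z : V) (hz : z ≠ x), g z = (h ⟨z, hz⟩).1 := by
  refine ⟨⟨g.toEquiv.subtypeEquiv fun z => ?_, ?_⟩, fun z hz => rfl⟩
  · change z ≠ x ↔ g z ≠ y
    rw [not_iff_not]
    exact ⟨fun h => (congrArg g h).trans hg, fun h => g.injective (h.trans hg.symm)⟩
  · rintro ⟨u, hu⟩ ⟨v, hv⟩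
    have hu' : g u ≠ y := fun h => hu (g.injective (h.trans hg.symm))
    have hv' : g v ≠ y := fun h => hv (g.injective (h.trans hg.symm))
    have : Q.graph.Adj (g u) (g v) ↔ P.graph.Adj u v := by
      rw [← P.adj_deleteEdges_iff (r := x) (fun h => hu h.1) (fun h => hv h.2),
        ← Q.adj_deleteEdges_iff (r := y) (fun h => hu' h.1) (fun h => hv' h.2)]
      exact g.map_adj_iff
    exact this

end ParentTree

/-! ### Binary words, languages and joins -/

/-- `v` extends `u` by one letter. -/
def Extends (u v : List Bool) : Prop := ∃ b, v = u ++ [b]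

theorem ext_cons_cons {b c : Bool} {u v : List Bool} : Extends (b :: u) (c :: v) ↔ b = c ∧ Extends u v := by
  simp only [Extends, List.cons_append, List.cons.injEq]
  grind

theorem not_ext_nil_right {u : List Bool} : ¬ Extends u [] := by simp [Extends]

theorem ext_nil_cons {b : Bool} {v : List Bool} : Extends [] (b :: v) ↔ v = [] := by simp [Extends]

theorem ext_append_left {w u v : List Bool} : Extends (w ++ u) (w ++ v) ↔ Extends u v := by
  simp [Extends, List.append_assoc]

theorem ext_iff_dropLast {u v : List Bool} : Extends u v ↔ v ≠ [] ∧ v.dropLast = u := by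
  constructor
  · rintro ⟨b, rfl⟩; simp
  · rintro ⟨h, rfl⟩; exact ⟨v.getLast h, (List.dropLast_append_getLast h).symm⟩

theorem Extends.ne {u v : List Bool} (h : Extends u v) : u ≠ v := by
  rintro rfl; obtain ⟨b, hb⟩ := h; simpa using congrArg List.length hb

/-- The rooted infinite binary tree. -/
def wordGraph : SimpleGraph (List Bool) where
  Adj u v := Extends u v ∨ Extends v u
  symm := ⟨fun _ _ h => h.symm⟩
  loopless := ⟨fun _ h => h.elim (fun h => h.ne rfl) (fun h => h.ne rfl)⟩

/-- Two rooted infinite binary trees whose roots are joined by an edge. -/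
def ambient : SimpleGraph (List Bool ⊕ List Bool) where
  Adj
    | .inl u, .inl v => Extends u v ∨ Extends v u
    | .inr u, .inr v => Extends u v ∨ Extends v u
    | .inl u, .inr v => u = [] ∧ v = []
    | .inr u, .inl v => u = [] ∧ v = []
  symm := ⟨by rintro (u | u) (v | v) h <;> first | exact Or.symm h | exact And.symm h⟩
  loopless := ⟨by rintro (u | u) h <;> exact h.elim (fun h => h.ne rfl) (fun h => h.ne rfl)⟩

@[simp] theorem ambient_inl_inl {u v : List Bool} :
    ambient.Adj (.inl u) (.inl v) ↔ Extends u v ∨ Extends v u := Iff.rfl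
@[simp] theorem ambient_inr_inr {u v : List Bool} :
    ambient.Adj (.inr u) (.inr v) ↔ Extends u v ∨ Extends v u := Iff.rfl
@[simp] theorem ambient_inl_inr {u v : List Bool} :
    ambient.Adj (.inl u) (.inr v) ↔ u = [] ∧ v = [] := Iff.rfl
@[simp] theorem ambient_inr_inl {u v : List Bool} :
    ambient.Adj (.inr u) (.inl v) ↔ u = [] ∧ v = [] := Iff.rfl

/-- Parents in the binary tree with respect to the end `true, true, …`. -/
def upWord : List Bool → List Bool
  | [] => [true]
  | true :: w => true :: upWord w
  | false :: w => (false :: w).dropLast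

/-- Parents in `ambient` with respect to the end `true, true, …` on the right. -/
def up : List Bool ⊕ List Bool → List Bool ⊕ List Bool
  | .inl [] => .inr []
  | .inl (b :: w) => .inl (b :: w).dropLast
  | .inr w => .inr (upWord w)

/-- The height of a word, increasing towards the end `true, true, …`. -/
def htWord : List Bool → ℤ
  | [] => 1
  | true :: w => 1 + htWord w
  | false :: w => - w.length

def ht : List Bool ⊕ List Bool → ℤ
  | .inl w => - w.length
  | .inr w => htWord w

theorem htWord_upWord (w : List Bool) : htWord (upWord w) = htWord w + 1 := by
  induction w with
  | nil => rfl
  | cons b w ih =>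
    cases b with
    | true => simp only [upWord, htWord, ih]; ring
    | false =>
      cases w with
      | nil => rfl
      | cons c w => simp [upWord, htWord]

theorem ht_up (x : List Bool ⊕ List Bool) : ht (up x) = ht x + 1 := by
  rcases x with (_ | ⟨b, w⟩) | w
  · rfl
  · simp [up, ht]
  · exact htWord_upWord w

/-- Orienting the binary tree towards the end `true, true, …` instead of its root reverses only the
edges along that ray; the underlying graph is the same. -/
theorem ext_or_ext_iff_upWord {u v : List Bool} :
    (Extends u v ∨ Extends v u) ↔ (upWord u = v ∨ upWord v = u) := by
  induction u generalizing v with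
  | nil =>
    rcases v with _ | ⟨b, v⟩
    · simp [not_ext_nil_right, upWord]
    · cases b with
      | true => simp [not_ext_nil_right, ext_nil_cons, upWord, eq_comm]
      | false =>
        simp only [not_ext_nil_right, ext_nil_cons, upWord]
        cases v <;> simp
  | cons b u ih =>
    rcases v with _ | ⟨c, v⟩
    · cases b with
      | true => simp [not_ext_nil_right, ext_nil_cons, upWord, eq_comm]
      | false =>
        simp only [not_ext_nil_right, ext_nil_cons, upWord]
        cases u <;> simp
    · cases b <;> cases c
      · simp only [upWord, ext_iff_dropLast, eq_comm]
        simp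
        tauto
      · rcases u with _ | ⟨d, u⟩ <;> simp [ext_cons_cons, upWord]
      · rcases v with _ | ⟨d, v⟩ <;> simp [ext_cons_cons, upWord]
      · simp [ext_cons_cons, upWord, ih]

theorem ambient_adj_iff {x y : List Bool ⊕ List Bool} :
    ambient.Adj x y ↔ up x = y ∨ up y = x := by
  rcases x with u | u <;> rcases y with v | v
  · rw [ambient_inl_inl, ext_iff_dropLast, ext_iff_dropLast]
    cases u <;> cases v <;> simp [up] <;> tauto
  · cases u <;> simp [up, eq_comm]
  · cases v <;> simp [up, eq_comm]
  · simp [ext_or_ext_iff_upWord, up]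

/-- The automorphism of `ambient` that moves the joining edge one step towards the end
`true, true, …`. -/
def rot : ambient ≃g ambient where
  toFun
    | .inl w => .inl (true :: w)
    | .inr [] => .inl []
    | .inr (false :: w) => .inl (false :: w)
    | .inr (true :: w) => .inr w
  invFun
    | .inl [] => .inr []
    | .inl (false :: w) => .inr (false :: w)
    | .inl (true :: w) => .inl w
    | .inr w => .inr (true :: w)
  left_inv := by rintro (w | (_ | ⟨_ | _, w⟩)) <;> rfl
  right_inv := by rintro ((_ | ⟨_ | _, w⟩) | w) <;> rfl
  map_rel_iff' := by
    rintro (u | (_ | ⟨_ | _, u⟩)) (v | (_ | ⟨_ | _, v⟩)) <;>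
      simp [ext_cons_cons, ext_nil_cons, not_ext_nil_right]

@[simp] theorem rot_inl (w : List Bool) : rot (.inl w) = .inl (true :: w) := rfl
@[simp] theorem rot_inr_nil : rot (.inr []) = .inl [] := rfl
@[simp] theorem rot_inr_false (w : List Bool) : rot (.inr (false :: w)) = .inl (false :: w) := rfl
@[simp] theorem rot_inr_true (w : List Bool) : rot (.inr (true :: w)) = .inr w := rfl

/-- The automorphism of `ambient` that exchanges the children of the root on the right. -/
def swapRight : ambient ≃g ambient where
  toFun
    | .inl w => .inl w
    | .inr [] => .inr []
    | .inr (b :: w) => .inr ((!b) :: w)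
  invFun
    | .inl w => .inl w
    | .inr [] => .inr []
    | .inr (b :: w) => .inr ((!b) :: w)
  left_inv := by rintro (w | (_ | ⟨_ | _, w⟩)) <;> rfl
  right_inv := by rintro (w | (_ | ⟨_ | _, w⟩)) <;> rfl
  map_rel_iff' := by
    rintro (u | (_ | ⟨b, u⟩)) (v | (_ | ⟨c, v⟩)) <;>
      simp [ext_cons_cons, ext_nil_cons, not_ext_nil_right]

/-- The automorphism of `ambient` that exchanges the two binary trees. -/
def swapSides : ambient ≃g ambient where
  toEquiv := Equiv.sumComm _ _
  map_rel_iff' := by rintro (u | u) (v | v) <;> simp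

/-- `rot` is a translation along a line through the end used by `up`, so it fixes that end and
respects parents. -/
theorem rot_up (x : List Bool ⊕ List Bool) : rot (up x) = up (rot x) := by
  rcases x with (_ | ⟨b, w⟩) | (_ | ⟨_ | _, w⟩)
  · rfl
  · simp [up]
  · rfl
  · rcases w with _ | ⟨c, w⟩
    · rfl
    · simp [up, upWord]
  · simp [up, upWord]

theorem rot_iterate_up (k : ℕ) (x : List Bool ⊕ List Bool) : rot^[k] (up x) = up (rot^[k] x) := by
  induction k generalizing x with
  | zero => rfl
  | succ k ih => rw [Function.iterate_succ_apply, Function.iterate_succ_apply, rot_up, ih]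

theorem rot_iterate_inl (k : ℕ) (w : List Bool) :
    rot^[k] (.inl w) = .inl (List.replicate k true ++ w) := by
  induction k generalizing w with
  | zero => rfl
  | succ k ih =>
    rw [Function.iterate_succ_apply, rot_inl, ih, List.replicate_succ']; simp

theorem exists_iso_eq_rot_iterate (k : ℕ) : ∃ A : ambient ≃g ambient, ∀ x, A x = rot^[k] x := by
  induction k with
  | zero => exact ⟨.refl, fun _ => rfl⟩
  | succ k ih =>
    obtain ⟨A, hA⟩ := ih
    exact ⟨rot.trans A, fun x => hA (rot x)⟩

/-- Every vertex moves to the left when the joining edge is moved towards the end. -/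
theorem exists_rot_iterate_eq_inl (x : List Bool ⊕ List Bool) : ∃ k w, rot^[k] x = .inl w := by
  rcases x with w | w
  · exact ⟨0, w, rfl⟩
  · induction w with
    | nil => exact ⟨1, [], rfl⟩
    | cons b w ih =>
      cases b with
      | false => exact ⟨1, false :: w, rfl⟩
      | true =>
        obtain ⟨k, v, h⟩ := ih
        exact ⟨k + 1, v, h⟩

theorem up_iterate_inl (u v : List Bool) : up^[v.length] (.inl (u ++ v)) = .inl u := by
  induction v using List.reverseRecOn with
  | nil => simp
  | append_singleton v b ih =>
    rw [List.length_append, List.length_singleton, Function.iterate_succ_apply]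
    have : up (.inl (u ++ (v ++ [b]))) = .inl (u ++ v) := by
      rw [← List.append_assoc]
      cases h : u ++ v with
      | nil => rfl
      | cons c w =>
        change Sum.inl ((c :: (w ++ [b])).dropLast) = _
        rw [← List.cons_append, List.dropLast_concat]
    rw [this, ih]

theorem up_eq_inl_iff {x : List Bool ⊕ List Bool} {u : List Bool} :
    up x = .inl u ↔ ∃ b, x = .inl (u ++ [b]) := by
  constructor
  · rcases x with (_ | ⟨b, w⟩) | w
    · simp [up]
    · intro h
      simp only [up, Sum.inl.injEq] at h
      exact ⟨(b :: w).getLast (by simp), by rw [← h, List.dropLast_append_getLast]⟩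
    · simp [up]
  · rintro ⟨b, rfl⟩
    exact up_iterate_inl u [b]

theorem up_iterate_eq_inl_iff {x : List Bool ⊕ List Bool} {u : List Bool} :
    (∃ k, up^[k] x = .inl u) ↔ ∃ v, x = .inl (u ++ v) := by
  constructor
  · rintro ⟨k, hk⟩
    induction k generalizing x with
    | zero => exact ⟨[], by simpa using hk⟩
    | succ k ih =>
      obtain ⟨v, hv⟩ := ih hk
      obtain ⟨b, rfl⟩ := up_eq_inl_iff.1 hv
      exact ⟨v ++ [b], by simp⟩
  · rintro ⟨v, rfl⟩
    exact ⟨_, up_iterate_inl u v⟩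

/-! ### Operations on languages and on joins -/

/-- The language of words that are empty or continue with a word of `L` after `true`, or with a
word of `M` after `false`. -/
def node (L M : Set (List Bool)) : Set (List Bool)
  | [] => True
  | true :: w => w ∈ L
  | false :: w => w ∈ M

@[simp] theorem nil_mem_node {L M : Set (List Bool)} : [] ∈ node L M := trivial
@[simp] theorem true_mem_node {L M : Set (List Bool)} {w : List Bool} :
    true :: w ∈ node L M ↔ w ∈ L := Iff.rfl
@[simp] theorem false_mem_node {L M : Set (List Bool)} {w : List Bool} :
    false :: w ∈ node L M ↔ w ∈ M := Iff.rfl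

/-- The language `L` without the words that start with `w`. -/
def prune (L : Set (List Bool)) (w : List Bool) : Set (List Bool) := {v | v ∈ L ∧ ¬ w <+: v}

theorem mem_prune {L : Set (List Bool)} {w v : List Bool} : v ∈ prune L w ↔ v ∈ L ∧ ¬ w <+: v :=
  Iff.rfl

@[simp] theorem prune_nil (L : Set (List Bool)) : prune L [] = ∅ := by
  ext v; simp [mem_prune]

@[simp] theorem prune_node_true (L M : Set (List Bool)) (w : List Bool) :
    prune (node L M) (true :: w) = node (prune L w) M := by
  ext (_ | ⟨_ | _, v⟩) <;> simp [mem_prune]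

@[simp] theorem prune_node_false (L M : Set (List Bool)) (w : List Bool) :
    prune (node L M) (false :: w) = node L (prune M w) := by
  ext (_ | ⟨_ | _, v⟩) <;> simp [mem_prune]

/-- The vertices of the join of the trees with languages `L` and `M`. -/
def join (L M : Set (List Bool)) : Set (List Bool ⊕ List Bool) := {x | Sum.elim (· ∈ L) (· ∈ M) x}

@[simp] theorem inl_mem_join {L M : Set (List Bool)} {w : List Bool} :
    Sum.inl w ∈ join L M ↔ w ∈ L := Iff.rfl
@[simp] theorem inr_mem_join {L M : Set (List Bool)} {w : List Bool} :
    Sum.inr w ∈ join L M ↔ w ∈ M := Iff.rfl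

/-- Some automorphism of `ambient` maps the join of `L` and `M` to the join of `L'` and `M'`. -/
def JoinEquiv (L M L' M' : Set (List Bool)) : Prop :=
  ∃ A : ambient ≃g ambient, ∀ x, A x ∈ join L' M' ↔ x ∈ join L M

namespace JoinEquiv

variable {L M L' M' L'' M'' N : Set (List Bool)}

theorem refl (L M : Set (List Bool)) : JoinEquiv L M L M := ⟨.refl, fun _ => Iff.rfl⟩

theorem trans (h : JoinEquiv L M L' M') (h' : JoinEquiv L' M' L'' M'') :
    JoinEquiv L M L'' M'' := by
  obtain ⟨A, hA⟩ := h
  obtain ⟨B, hB⟩ := h'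
  exact ⟨A.trans B, fun x => (hB (A x)).trans (hA x)⟩

theorem symm (h : JoinEquiv L M L' M') : JoinEquiv L' M' L M := by
  obtain ⟨A, hA⟩ := h
  exact ⟨A.symm, fun x => by rw [← hA, RelIso.apply_symm_apply]⟩

theorem comm (L M : Set (List Bool)) : JoinEquiv L M M L :=
  ⟨swapSides, by rintro (w | w) <;> rfl⟩

theorem rot (L M N : Set (List Bool)) : JoinEquiv L (node M N) (node L N) M :=
  ⟨_root_.rot, by rintro (w | (_ | ⟨_ | _, w⟩)) <;> simp⟩

theorem swap (L M N : Set (List Bool)) : JoinEquiv L (node M N) L (node N M) :=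
  ⟨swapRight, by rintro (w | (_ | ⟨_ | _, w⟩)) <;> simp [swapRight]⟩

end JoinEquiv

/-- A path with pendant trees `l` that ends in `E`. -/
def chain (l : List (Set (List Bool))) (E : Set (List Bool)) : Set (List Bool) :=
  l.foldr (fun p r => node r p) E

/-- One rotation per vertex of the path moves the joining edge from its start to its end. The path
is then read from the other side, which reverses the pendant trees. -/
theorem JoinEquiv.chain (l : List (Set (List Bool))) (E R : Set (List Bool)) :
    JoinEquiv R (_root_.chain l E) (_root_.chain l.reverse R) E := by
  induction l generalizing R with
  | nil => exact JoinEquiv.refl _ _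
  | cons p l ih =>
    refine (JoinEquiv.rot _ _ _).trans ((ih _).trans ?_)
    rw [List.reverse_cons, _root_.chain, _root_.chain, List.foldr_append]
    exact JoinEquiv.refl _ _

/-! ### Trees along a spine -/

/-- The language seen from the `k`-th vertex of the spine when looking upwards. -/
def upper (side : ℕ → Set (List Bool)) : ℕ → Set (List Bool)
  | _, [] => True
  | k, true :: w => upper side (k + 1) w
  | k, false :: w => w ∈ side k

/-- The language seen from the `k`-th vertex of the spine when looking downwards. -/
def lower (base : Set (List Bool)) (side : ℕ → Set (List Bool)) : ℕ → Set (List Bool)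
  | 0 => base
  | k + 1 => node (lower base side k) (side (k + 1))

theorem upper_eq_node (side : ℕ → Set (List Bool)) (k : ℕ) :
    upper side k = node (upper side (k + 1)) (side k) := by
  ext (_ | ⟨_ | _, w⟩) <;> rfl

/-- A language is closed under deleting the last letter. -/
def DropClosed (L : Set (List Bool)) : Prop := ∀ w ∈ L, w.dropLast ∈ L

theorem upWord_mem_upper {side : ℕ → Set (List Bool)} (h : ∀ k, DropClosed (side k)) {k : ℕ}
    {w : List Bool} (hw : w ∈ upper side k) : upWord w ∈ upper side k := by
  induction w generalizing k with
  | nil => exact trivial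
  | cons b w ih =>
    cases b with
    | true => exact ih (k := k + 1) hw
    | false =>
      cases w with
      | nil => exact trivial
      | cons c w => exact h k _ hw

theorem exists_up_iterate_eq (x : List Bool ⊕ List Bool) :
    ∃ k j, up^[k] x = .inr (List.replicate j true) := by
  have main : ∀ w, ∃ k j, up^[k] (.inr w) = .inr (List.replicate j true) := by
    intro w
    induction w with
    | nil => exact ⟨0, 0, rfl⟩
    | cons b w ih =>
      cases b with
      | true =>
        obtain ⟨k, j, h⟩ := ih
        refine ⟨k, j + 1, ?_⟩
        have : ∀ (k : ℕ) (w : List Bool), up^[k] (.inr (true :: w)) =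
            Sum.map id (true :: ·) (up^[k] (.inr w)) := by
          intro k
          induction k with
          | zero => exact fun _ => rfl
          | succ k ih => exact fun w => ih (upWord w)
        rw [this, h]; rfl
      | false =>
        refine ⟨w.length + 1, 0, ?_⟩
        clear ih
        induction w using List.reverseRecOn with
        | nil => rfl
        | append_singleton w b ih =>
          rw [List.length_append, List.length_singleton, Function.iterate_succ_apply]
          have : up (.inr (false :: (w ++ [b]))) = .inr (false :: w) := by
            change Sum.inr ((false :: (w ++ [b])).dropLast) = _
            rw [← List.cons_append, List.dropLast_concat]
          rw [this, ih]
  rcases x with w | w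
  · obtain ⟨k, j, h⟩ := main []
    refine ⟨k + (1 + w.length), j, ?_⟩
    have := up_iterate_inl [] w
    rw [List.nil_append] at this
    rw [Function.iterate_add_apply, Function.iterate_add_apply, this]
    exact h
  · exact main w

theorem up_iterate_replicate (l j : ℕ) :
    up^[l] (.inr (List.replicate j true)) = .inr (List.replicate (j + l) true) := by
  induction l generalizing j with
  | zero => rfl
  | succ l ih =>
    have : ∀ j, upWord (List.replicate j true) = List.replicate (j + 1) true := by
      intro j
      induction j with
      | zero => rfl
      | succ j ih => simp only [List.replicate_succ, upWord] at ih ⊢; rw [ih]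
    rw [Function.iterate_succ_apply, up, this, ih]
    congr 2; omega

section spineTree

variable (base : Set (List Bool)) (side : ℕ → Set (List Bool))

/-- The vertices of the tree with base `base` and side trees `side k` along the spine. -/
abbrev SpineVertex : Type := ↥(join base (upper side 1))

theorem up_mem (hb : DropClosed base) (hs : ∀ k, DropClosed (side k))
    (x : List Bool ⊕ List Bool) (hx : x ∈ join base (upper side 1)) :
    up x ∈ join base (upper side 1) := by
  rcases x with (_ | ⟨b, w⟩) | w
  · exact trivial
  · exact hb _ hx
  · exact upWord_mem_upper hs hx

theorem coe_iterate_up (hb : DropClosed base) (hs : ∀ k, DropClosed (side k)) (k : ℕ)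
    (x : SpineVertex base side) :
    (((fun x => ⟨up x.1, up_mem base side hb hs x.1 x.2⟩ : SpineVertex base side → _)^[k] x :
      SpineVertex base side) : List Bool ⊕ List Bool) = up^[k] x.1 := by
  induction k generalizing x with
  | zero => rfl
  | succ k ih => rw [Function.iterate_succ_apply, ih]; rfl

/-- The tree with base `base` and side trees `side k` along the spine. -/
def spineTree (hb : DropClosed base) (hs : ∀ k, DropClosed (side k)) :
    ParentTree (SpineVertex base side) where
  par x := ⟨up x.1, up_mem base side hb hs x.1 x.2⟩
  ht x := ht x.1
  ht_par x := ht_up x.1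
  meet x y := by
    obtain ⟨k, j, h⟩ := exists_up_iterate_eq x.1
    obtain ⟨l, i, h'⟩ := exists_up_iterate_eq y.1
    -- The two vertices reach the spine at heights `j` and `i` after `k` and `l` steps; further `i`
    -- and `j` steps bring both to `i + j`.
    refine ⟨i + k, j + l, Subtype.ext ?_⟩
    rw [coe_iterate_up base side hb hs, coe_iterate_up base side hb hs, Function.iterate_add_apply, Function.iterate_add_apply, h,
      h', up_iterate_replicate, up_iterate_replicate, add_comm]

variable {base side}

theorem spineTree_adj_iff {hb : DropClosed base} {hs : ∀ k, DropClosed (side k)}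
    {x y : SpineVertex base side} :
    (spineTree base side hb hs).graph.Adj x y ↔ ambient.Adj x.1 y.1 := by
  rw [ParentTree.adj_iff, ambient_adj_iff, ← Subtype.coe_inj, ← Subtype.coe_inj]; rfl

/-- After `k` rotations the joining edge is the one between the spine vertices `k` and `k + 1`, so
the tree splits into what lies below and what lies above it. -/
theorem rot_iterate_mem_iff (k : ℕ) (x : List Bool ⊕ List Bool) :
    rot^[k] x ∈ join (lower base side k) (upper side (k + 1)) ↔ x ∈ join base (upper side 1) := by
  induction k with
  | zero => rfl
  | succ k ih =>
    rw [← ih, Function.iterate_succ_apply', upper_eq_node side (k + 1), lower]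
    rcases rot^[k] x with w | (_ | ⟨_ | _, w⟩) <;> simp

/-- On the left of the joining edge, parents are obtained by dropping the last letter. Once `x` has
been rotated there, its descendants are the extensions of its address. -/
theorem mem_desc_iff {hb : DropClosed base} {hs : ∀ k, DropClosed (side k)}
    {x z : SpineVertex base side} {k : ℕ} {w : List Bool} (hx : rot^[k] x.1 = .inl w) :
    z ∈ (spineTree base side hb hs).desc x ↔ ∃ v, rot^[k] z.1 = .inl (w ++ v) := by
  obtain ⟨A, hA⟩ := exists_iso_eq_rot_iterate k
  have hup : ∀ (j : ℕ) (y : List Bool ⊕ List Bool), rot^[k] (up^[j] y) = up^[j] (rot^[k] y) := by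
    intro j
    induction j with
    | zero => exact fun _ => rfl
    | succ j ih =>
      intro y
      rw [Function.iterate_succ_apply, ih, rot_iterate_up, Function.iterate_succ_apply]
  rw [← up_iterate_eq_inl_iff]
  refine exists_congr fun j => ?_
  rw [← hup, ← hx, ← hA, ← hA, A.injective.eq_iff, ← coe_iterate_up base side hb hs,
    Subtype.coe_inj]
  rfl

theorem exists_desc_iso {hb : DropClosed base} {hs : ∀ k, DropClosed (side k)}
    {x : SpineVertex base side} {k : ℕ} {w : List Bool} (hx : rot^[k] x.1 = .inl w) :
    ∃ e : wordGraph.induce {v | w ++ v ∈ lower base side k} ≃g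
        (spineTree base side hb hs).graph.induce ((spineTree base side hb hs).desc x),
      ∀ v, rot^[k] (e v).1.1 = .inl (w ++ v.1) := by
  obtain ⟨A, hA⟩ := exists_iso_eq_rot_iterate k
  have hm : ∀ v, w ++ v ∈ lower base side k → A.symm (.inl (w ++ v)) ∈ join base (upper side 1) := by
    intro v hv
    rw [← rot_iterate_mem_iff k, ← hA, RelIso.apply_symm_apply]
    exact hv
  have hr : ∀ v, rot^[k] (A.symm (.inl (w ++ v))) = .inl (w ++ v) := fun v => by
    rw [← hA, RelIso.apply_symm_apply]
  let f : {v | w ++ v ∈ lower base side k} → (spineTree base side hb hs).desc x := fun v =>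
    ⟨⟨A.symm (.inl (w ++ v.1)), hm v.1 v.2⟩, (mem_desc_iff hx).2 ⟨v.1, hr v.1⟩⟩
  have hf : Function.Bijective f := by
    constructor
    · intro u v h
      have := congrArg (fun z => rot^[k] z.1.1) h
      simp only [f, hr, Sum.inl.injEq, List.append_cancel_left_eq] at this
      exact Subtype.ext this
    · rintro ⟨z, hz⟩
      obtain ⟨v, hv⟩ := (mem_desc_iff hx).1 hz
      have hv' : w ++ v ∈ lower base side k := by
        have := (rot_iterate_mem_iff k z.1).2 z.2
        rwa [hv] at this
      refine ⟨⟨v, hv'⟩, Subtype.ext (Subtype.ext ?_)⟩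
      simp only [f]
      rw [← hv, ← hA, RelIso.symm_apply_apply]
  refine ⟨⟨Equiv.ofBijective f hf, ?_⟩, fun v => hr v.1⟩
  intro u v
  change (spineTree base side hb hs).graph.Adj (f u).1 (f v).1 ↔ (Extends u.1 v.1 ∨ Extends v.1 u.1)
  rw [spineTree_adj_iff]
  simp only [f]
  rw [A.symm.map_adj_iff, ambient_inl_inl, ext_append_left, ext_append_left]

end spineTree

/-- The two sides of the deleted edge are compared separately: `hsub` identifies the subtrees below,
and `hjoin` identifies the rest, which is the pruned lower part joined to the upper part. -/
theorem spineTree_exchangeable {base base' : Set (List Bool)} {side side' : ℕ → Set (List Bool)}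
    {hb : DropClosed base} {hs : ∀ k, DropClosed (side k)} {hb' : DropClosed base'}
    {hs' : ∀ k, DropClosed (side' k)} {x : SpineVertex base side} {y : SpineVertex base' side'}
    {k k' : ℕ} {w w' : List Bool} (hx : rot^[k] x.1 = .inl w) (hy : rot^[k'] y.1 = .inl w')
    (hsub : ∀ v, w ++ v ∈ lower base side k ↔ w' ++ v ∈ lower base' side' k')
    (hjoin : JoinEquiv (prune (lower base side k) w) (upper side (k + 1))
      (prune (lower base' side' k') w') (upper side' (k' + 1))) :
    (spineTree base side hb hs).Exchangeable (spineTree base' side' hb' hs') x y := by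
  obtain ⟨e, he⟩ := exists_desc_iso (hb := hb) (hs := hs) hx
  obtain ⟨e', he'⟩ := exists_desc_iso (hb := hb') (hs := hs') hy
  obtain ⟨A, hA⟩ := exists_iso_eq_rot_iterate k
  obtain ⟨A', hA'⟩ := exists_iso_eq_rot_iterate k'
  obtain ⟨B, hB⟩ := hjoin
  have hset : {v | w ++ v ∈ lower base side k} = {v | w' ++ v ∈ lower base' side' k'} :=
    Set.ext hsub
  let β := e.symm.trans ((SimpleGraph.Iso.induce (s := {v | w ++ v ∈ lower base side k})
    (t := {v | w' ++ v ∈ lower base' side' k'}) (.refl : wordGraph ≃g wordGraph)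
    (hset ▸ Set.bijOn_id _)).trans e')
  have inj : ∀ z z', rot^[k'] z = rot^[k'] z' → z = z' := fun z z' h => by
    rw [← hA', ← hA'] at h; exact A'.injective h
  -- In rotated coordinates the non-descendants of `x` form exactly the join that occurs in `hjoin`.
  have mem_out : ∀ {base : Set (List Bool)} {side : ℕ → Set (List Bool)} {hb : DropClosed base}
      {hs : ∀ k, DropClosed (side k)} {x : SpineVertex base side} {k : ℕ} {w : List Bool}
      (hx : rot^[k] x.1 = .inl w) (z : List Bool ⊕ List Bool),
      (∃ h : z ∈ join base (upper side 1), (⟨z, h⟩ : SpineVertex base side) ∈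
        ((spineTree base side hb hs).desc x)ᶜ) ↔
      rot^[k] z ∈ join (prune (lower base side k) w) (upper side (k + 1)) := by
    intro base side hb hs x k w hx z
    simp only [Set.mem_compl_iff, mem_desc_iff hx]
    rw [← rot_iterate_mem_iff k z, exists_prop]
    rcases rot^[k] z with u | u
    · simp [mem_prune, List.IsPrefix, eq_comm]
    · simp
  let Θ : ambient ≃g ambient := (A.trans B).trans A'.symm
  have hΘ : ∀ z, (∃ h : Θ z ∈ join base' (upper side' 1), (⟨Θ z, h⟩ : SpineVertex base' side') ∈
      ((spineTree base' side' hb' hs').desc y)ᶜ) ↔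
      ∃ h : z ∈ join base (upper side 1), (⟨z, h⟩ : SpineVertex base side) ∈
        ((spineTree base side hb hs).desc x)ᶜ := by
    intro z
    rw [mem_out hx, mem_out hy, ← hA', ← hA]
    simp only [Θ, RelIso.trans_apply, RelIso.apply_symm_apply]
    exact hB _
  let α : (spineTree base side hb hs).graph.induce ((spineTree base side hb hs).desc x)ᶜ ≃g
      (spineTree base' side' hb' hs').graph.induce ((spineTree base' side' hb' hs').desc y)ᶜ :=
    { toFun := fun z => ⟨⟨Θ z.1.1, ((hΘ z.1.1).2 ⟨z.1.2, z.2⟩).1⟩, ((hΘ z.1.1).2 ⟨z.1.2, z.2⟩).2⟩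
      invFun := fun z => by
        have := (hΘ (Θ.symm z.1.1)).1 (by
          rw [RelIso.apply_symm_apply]; exact ⟨z.1.2, z.2⟩)
        exact ⟨⟨Θ.symm z.1.1, this.1⟩, this.2⟩
      left_inv := fun z => Subtype.ext (Subtype.ext (Θ.symm_apply_apply _))
      right_inv := fun z => Subtype.ext (Subtype.ext (Θ.apply_symm_apply _))
      map_rel_iff' := by
        intro u v
        change (spineTree base' side' hb' hs').graph.Adj _ _ ↔ (spineTree base side hb hs).graph.Adj _ _
        rw [spineTree_adj_iff, spineTree_adj_iff]
        exact Θ.map_adj_iff }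
  refine ParentTree.exchangeable_of_iso α β ?_
  -- The root of the lower subtree has the empty address on both sides, so `x` goes to `y`.
  set u := e.symm ⟨x, (spineTree base side hb hs).self_mem_desc x⟩ with hu
  have h1 : u.1 = [] := by
    have := he u
    rw [hu, RelIso.apply_symm_apply, hx] at this
    simpa using this.symm
  refine Subtype.ext (inj _ _ ?_)
  rw [hy]
  change rot^[k'] (e' _).1.1 = _
  rw [he']
  change Sum.inl (w' ++ u.1) = _
  rw [h1, List.append_nil]

/-! ### The state machine -/

theorem exists_schedule (α : Type) [Countable α] [Nonempty α] :
    ∃ s : ℕ → α, ∀ a N, ∃ n, N ≤ n ∧ s n = a := by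
  obtain ⟨f, hf⟩ := exists_surjective_nat α
  refine ⟨fun n => f n.unpair.2, fun a N => ?_⟩
  obtain ⟨m, rfl⟩ := hf a
  exact ⟨Nat.pair N m, Nat.left_le_pair N m, by simp⟩

/-- A sequence in which every side, level and word occurs infinitely often. -/
noncomputable def schedule : ℕ → Bool × ℕ × List Bool := (exists_schedule _).choose

theorem schedule_spec : ∀ a N, ∃ n, N ≤ n ∧ schedule n = a := (exists_schedule _).choose_spec

/-- The tree in which a vertex is moved at the `n`-th step. -/
noncomputable def active (n : ℕ) : Bool := (schedule n).1

/-- The types of the vertices: `tree i n` is the root of the `n`-th approximation of the `i`-th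
tree, `cone i n` is the same vertex when seen from above, `link i n k` and `tail i n` are the
vertices of the path that is attached in the `n`-th step, `stem q` has a single child `q`, and
`cut q w` is `q` without the subtree at address `w`. -/
inductive State
  | leaf
  | stem (q : State)
  | tree (i : Bool) (n : ℕ)
  | cone (i : Bool) (n : ℕ)
  | link (i : Bool) (n k : ℕ)
  | tail (i : Bool) (n : ℕ)
  | cut (q : State) (w : List Bool)

open State

/-- For each step, the address of the vertex that is moved and its type. -/
abbrev Moves : Type := ℕ → Option (List Bool × State)

/-- The child of a vertex in a given direction. -/
noncomputable def child (d : Moves) : State → Bool → Option State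
  | leaf, _ => none
  | stem q, true => some q
  | stem _, false => none
  | tree _ 0, true => some leaf
  | tree _ 0, false => none
  | tree i (n + 1), true => some (stem (stem (tree i n)))
  | tree i (n + 1), false => some (link i n (2 * n + 1))
  | cone i n, true => some (stem (stem (cone i (n + 1))))
  | cone i n, false => some (link i n (2 * n + 1))
  | link i n 0, true => some (tail i n)
  | link i n (k + 1), true => some (link i n k)
  | link i n k, false =>
    -- The distinguished pendant always sits next to the end that belongs to the tree `false`. The
    -- two trees run through the link from opposite ends, hence the two indices.
    if k = bif i then 0 else 2 * n + 1 then
      if i = active n then some (stem leaf) else (d n).map fun p => stem (stem p.2)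
    else some leaf
  | tail i n, true =>
    if i = active n then some (stem (stem (tree (!i) n)))
    else (d n).map fun p => stem (stem (cut (tree (!i) n) p.1))
  | tail i n, false => some (stem (stem (cone (!i) (n + 1))))
  | cut q w, b =>
    if w = [b] then none
    else if w.head? = some b then (child d q b).map fun r => cut r w.tail
    else child d q b

/-- The type of the vertex at a given address. -/
noncomputable def run (d : Moves) : State → List Bool → Option State
  | q, [] => some q
  | q, b :: w => (child d q b).bind fun r => run d r w

@[simp] theorem run_nil (d : Moves) (q : State) : run d q [] = some q := rfl

@[simp] theorem run_cons (d : Moves) (q : State) (b : Bool) (w : List Bool) :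
    run d q (b :: w) = (child d q b).bind fun r => run d r w := rfl

theorem run_append (d : Moves) (q : State) (u v : List Bool) :
    run d q (u ++ v) = (run d q u).bind fun r => run d r v := by
  induction u generalizing q with
  | nil => simp
  | cons b u ih =>
    rw [List.cons_append, run_cons, run_cons, Option.bind_assoc]
    exact congrArg _ (funext ih)

/-- A child that depends on an undetermined move is `none`, so further moves only enlarge what has
been unfolded. -/
theorem child_mono {d d' : Moves} (h : ∀ n p, d n = some p → d' n = some p) {q r : State}
    {b : Bool} (hr : child d q b = some r) : child d' q b = some r := by
  induction q generalizing b r with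
  | leaf => cases b <;> exact hr
  | stem => cases b <;> exact hr
  | tree i n => cases b <;> cases n <;> exact hr
  | cone i n => cases b <;> exact hr
  | link i n k =>
    cases b with
    | true => cases k <;> exact hr
    | false =>
      simp only [child] at hr ⊢
      split_ifs at hr ⊢ <;> try exact hr
      rw [Option.map_eq_some_iff] at hr ⊢
      exact hr.imp fun p hp => ⟨h _ _ hp.1, hp.2⟩
  | tail i n =>
    cases b with
    | false => exact hr
    | true =>
      simp only [child] at hr ⊢
      split_ifs at hr ⊢ <;> try exact hr
      rw [Option.map_eq_some_iff] at hr ⊢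
      exact hr.imp fun p hp => ⟨h _ _ hp.1, hp.2⟩
  | cut q w ih =>
    rw [child] at hr ⊢
    split_ifs at hr ⊢
    · rw [Option.map_eq_some_iff] at hr ⊢
      exact hr.imp fun p hp => ⟨ih hp.1, hp.2⟩
    · exact ih hr

theorem run_mono {d d' : Moves} (h : ∀ n p, d n = some p → d' n = some p) {q r : State}
    {w : List Bool} (hr : run d q w = some r) : run d' q w = some r := by
  induction w generalizing q with
  | nil => exact hr
  | cons b w ih =>
    rw [run_cons, Option.bind_eq_some_iff] at hr ⊢
    exact hr.imp fun p hp => ⟨child_mono h hp.1, ih hp.2⟩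

/-- Only the moves before the `N`-th step. -/
def Moves.before (d : Moves) (N : ℕ) : Moves := fun n => if n < N then d n else none

theorem Moves.before_mono (d : Moves) {M N : ℕ} (h : M ≤ N) (n : ℕ) (p : List Bool × State)
    (hp : d.before M n = some p) : d.before N n = some p := by
  unfold Moves.before at *
  split_ifs at hp with h1
  rw [if_pos (h1.trans_le h), hp]

theorem Moves.before_le (d : Moves) (M : ℕ) (n : ℕ) (p : List Bool × State)
    (hp : d.before M n = some p) : d n = some p := by
  unfold Moves.before at *
  split_ifs at hp
  exact hp

theorem exists_child_before {d : Moves} {q r : State} {b : Bool} (hr : child d q b = some r) :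
    ∃ N, child (d.before N) q b = some r := by
  induction q generalizing b r with
  | leaf => exact ⟨0, by cases b <;> exact hr⟩
  | stem => exact ⟨0, by cases b <;> exact hr⟩
  | tree i n => exact ⟨0, by cases b <;> cases n <;> exact hr⟩
  | cone i n => exact ⟨0, by cases b <;> exact hr⟩
  | link i n k =>
    refine ⟨n + 1, ?_⟩
    have : d.before (n + 1) n = d n := if_pos (Nat.lt_succ_self n)
    cases b with
    | true => cases k <;> exact hr
    | false => simpa only [child, this] using hr
  | tail i n =>
    refine ⟨n + 1, ?_⟩
    have : d.before (n + 1) n = d n := if_pos (Nat.lt_succ_self n)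
    cases b with
    | false => exact hr
    | true => simpa only [child, this] using hr
  | cut q w ih =>
    rw [child] at hr
    split_ifs at hr with h1 h2
    · rw [Option.map_eq_some_iff] at hr
      obtain ⟨p, hp, rfl⟩ := hr
      obtain ⟨N, hN⟩ := ih hp
      exact ⟨N, by rw [child, if_neg h1, if_pos h2, hN]; rfl⟩
    · obtain ⟨N, hN⟩ := ih hr
      exact ⟨N, by rw [child, if_neg h1, if_neg h2, hN]⟩

/-- Reading a word consults only finitely many moves. Hence every vertex of the final tree becomes
available for moving from some step on. -/
theorem exists_run_before {d : Moves} {q r : State} {w : List Bool} (hr : run d q w = some r) :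
    ∃ N, run (d.before N) q w = some r := by
  induction w generalizing q with
  | nil => exact ⟨0, hr⟩
  | cons b w ih =>
    rw [run_cons, Option.bind_eq_some_iff] at hr
    obtain ⟨p, hp, hr⟩ := hr
    obtain ⟨M, hM⟩ := exists_child_before hp
    obtain ⟨N, hN⟩ := ih hr
    refine ⟨max M N, ?_⟩
    rw [run_cons, child_mono (d.before_mono (le_max_left M N)) hM]
    exact run_mono (d.before_mono (le_max_right M N)) hN

/-! ### Recursive choice of the moves -/

/-- The address proposed by the schedule for the `n`-th step. -/
noncomputable def candidate (n : ℕ) : List Bool :=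
  -- An entry `(i, k, w)` of the schedule names the vertex at address `w` below the spine vertex
  -- `k`; the letters `true` lead to that spine vertex from number `3 * n`.
  List.replicate (3 * n - (schedule n).2.1) true ++ (schedule n).2.2

open Classical in
/-- The address used in the `n`-th step if `d` are the earlier moves. -/
noncomputable def pick (d : Moves) (n : ℕ) : List Bool :=
  if candidate n ≠ [] ∧ (run d (tree (active n) n) (candidate n)).isSome then candidate n
  -- A harmless fallback: every state `tree i n` has a child in direction `true`, whatever the moves
  -- are.
  else [true]

/-- The vertex moved in the `n`-th step. -/
noncomputable def move (n : ℕ) : List Bool × State :=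
  let d : Moves := fun m => if _h : m < n then some (move m) else none
  (pick d n, (run d (tree (active n) n) (pick d n)).getD leaf)
termination_by n

/-- The sequence of all moves. -/
noncomputable def moves : Moves := fun n => some (move n)

/-- The address of the vertex moved in the `n`-th step. -/
noncomputable def addr (n : ℕ) : List Bool := (move n).1

/-- The type of the vertex moved in the `n`-th step. -/
noncomputable def moved (n : ℕ) : State := (move n).2

theorem moves_apply (n : ℕ) : moves n = some (addr n, moved n) := rfl

theorem move_eq (n : ℕ) : move n = (pick (moves.before n) n,
    (run (moves.before n) (tree (active n) n) (pick (moves.before n) n)).getD leaf) := by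
  have : (fun m => if _h : m < n then some (move m) else none) = moves.before n := by
    funext m
    rfl
  rw [move, this]

theorem run_tree_true_isSome (d : Moves) (i : Bool) (n : ℕ) :
    (run d (tree i n) [true]).isSome := by
  cases n <;> rfl

theorem pick_ne_nil (d : Moves) (n : ℕ) : pick d n ≠ [] := by
  unfold pick
  split_ifs with h
  · exact h.1
  · simp

theorem addr_ne_nil (n : ℕ) : addr n ≠ [] := by
  rw [addr, move_eq]
  exact pick_ne_nil _ _

theorem run_before_addr (n : ℕ) :
    run (moves.before n) (tree (active n) n) (addr n) = some (moved n) := by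
  have : (run (moves.before n) (tree (active n) n) (pick (moves.before n) n)).isSome := by
    unfold pick
    split_ifs with h
    · exact h.2
    · exact run_tree_true_isSome _ _ _
  rw [addr, moved, move_eq]
  obtain ⟨r, hr⟩ := Option.isSome_iff_exists.1 this
  rw [hr]
  rfl

theorem run_addr (n : ℕ) : run moves (tree (active n) n) (addr n) = some (moved n) :=
  run_mono (moves.before_le n) (run_before_addr n)

theorem addr_eq_candidate {n : ℕ} (h : candidate n ≠ []) {r : State}
    (hr : run (moves.before n) (tree (active n) n) (candidate n) = some r) :
    addr n = candidate n := by
  rw [addr, move_eq]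
  exact if_pos ⟨h, by rw [hr]; rfl⟩

/-! ### Languages of states -/

/-- The addresses below a vertex of type `q`. -/
def lang (q : State) : Set (List Bool) := {w | (run moves q w).isSome}

/-- The addresses below an optional vertex. -/
def optLang (o : Option State) : Set (List Bool) := {w | (o.bind fun q => run moves q w).isSome}

theorem mem_lang {q : State} {w : List Bool} : w ∈ lang q ↔ (run moves q w).isSome := Iff.rfl

@[simp] theorem optLang_none : optLang none = ∅ := by ext w; simp [optLang]

@[simp] theorem optLang_some (q : State) : optLang (some q) = lang q := rfl

theorem lang_eq_node (q : State) :
    lang q = node (optLang (child moves q true)) (optLang (child moves q false)) := by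
  ext (_ | ⟨_ | _, w⟩)
  · simp [mem_lang]
  · rfl
  · rfl

theorem dropClosed_lang (q : State) : DropClosed (lang q) := by
  intro w hw
  induction w using List.reverseRecOn with
  | nil => exact hw
  | append_singleton w b _ =>
    rw [mem_lang, run_append] at hw
    rw [List.dropLast_concat, mem_lang]
    exact Option.isSome_of_isSome_bind hw

theorem dropClosed_optLang (o : Option State) : DropClosed (optLang o) := by
  cases o with
  | none => simp [DropClosed]
  | some q => exact dropClosed_lang q

/-- The state `cut q w` passes the rest of `w` down the branch on which `w` lies and stops at its
last letter, which is how pruning acts on `node`. An empty `w` would cut nothing. -/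
theorem lang_cut (q : State) {w : List Bool} (hw : w ≠ []) :
    lang (cut q w) = prune (lang q) w := by
  induction w generalizing q with
  | nil => exact absurd rfl hw
  | cons b w ih =>
    have key : optLang (if b :: w = [b] then none
        else if (b :: w).head? = some b then (child moves q b).map fun r => cut r (b :: w).tail
        else child moves q b) = prune (optLang (child moves q b)) w := by
      by_cases h : w = []
      · subst h; simp
      · rw [if_neg (by simpa using h), if_pos List.head?_cons]
        cases child moves q b with
        | none => ext; simp [mem_prune]
        | some r => exact ih r h
    rw [lang_eq_node (cut q (b :: w)), lang_eq_node q]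
    cases b with
    | true =>
      rw [prune_node_true, child, child, key]
      simp
    | false =>
      rw [prune_node_false, child, child, key]
      simp

theorem lang_leaf : lang leaf = node ∅ ∅ := by rw [lang_eq_node]; simp [child]

theorem lang_stem (q : State) : lang (stem q) = node (lang q) ∅ := by
  rw [lang_eq_node]; simp [child]

theorem lang_tree_succ (i : Bool) (n : ℕ) : lang (tree i (n + 1)) =
    node (lang (stem (stem (tree i n)))) (lang (link i n (2 * n + 1))) := by
  rw [lang_eq_node]; simp [child]

/-! ### The spines -/

/-- The type of the `k`-th vertex of the spine, seen from below. -/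
def spine (i : Bool) (k : ℕ) : State := stem^[k % 3] (tree i (k / 3))

/-- The type of the `k+1`-st vertex of the spine, seen from above. -/
def top (i : Bool) (k : ℕ) : State := stem^[2 - k % 3] (cone i (k / 3))

theorem spine_three_mul (i : Bool) (n : ℕ) : spine i (3 * n) = tree i n := by
  simp [spine]

theorem spine_three_mul_add_one (i : Bool) (n : ℕ) : spine i (3 * n + 1) = stem (tree i n) := by
  rw [spine, show (3 * n + 1) % 3 = 1 by omega, show (3 * n + 1) / 3 = n by omega]; rfl

theorem spine_three_mul_add_two (i : Bool) (n : ℕ) :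
    spine i (3 * n + 2) = stem (stem (tree i n)) := by
  rw [spine, show (3 * n + 2) % 3 = 2 by omega, show (3 * n + 2) / 3 = n by omega]; rfl

theorem top_three_mul (i : Bool) (n : ℕ) : top i (3 * n) = stem (stem (cone i n)) := by
  simp [top]

theorem top_three_mul_add_one (i : Bool) (n : ℕ) : top i (3 * n + 1) = stem (cone i n) := by
  rw [top, show (3 * n + 1) % 3 = 1 by omega, show (3 * n + 1) / 3 = n by omega]; rfl

theorem top_three_mul_add_two (i : Bool) (n : ℕ) : top i (3 * n + 2) = cone i n := by
  rw [top, show (3 * n + 2) % 3 = 2 by omega, show (3 * n + 2) / 3 = n by omega]; rfl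

theorem eq_three_mul_add (k : ℕ) : ∃ n, k = 3 * n ∨ k = 3 * n + 1 ∨ k = 3 * n + 2 :=
  ⟨k / 3, by omega⟩

theorem child_spine_succ (d : Moves) (i : Bool) (k : ℕ) :
    child d (spine i (k + 1)) true = some (spine i k) := by
  obtain ⟨n, rfl | rfl | rfl⟩ := eq_three_mul_add k
  · rw [spine_three_mul, spine_three_mul_add_one]; rfl
  · rw [spine_three_mul_add_one, spine_three_mul_add_two]; rfl
  · rw [spine_three_mul_add_two, show 3 * n + 2 + 1 = 3 * (n + 1) by ring, spine_three_mul]; rfl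

theorem child_top_true (i : Bool) (k : ℕ) :
    child moves (top i k) true = some (top i (k + 1)) := by
  obtain ⟨n, rfl | rfl | rfl⟩ := eq_three_mul_add k
  · rw [top_three_mul, top_three_mul_add_one]; rfl
  · rw [top_three_mul_add_one, top_three_mul_add_two]; rfl
  · rw [top_three_mul_add_two, show 3 * n + 2 + 1 = 3 * (n + 1) by ring, top_three_mul]; rfl

/-- `top i k` and `spine i (k + 1)` describe one spine vertex, approached from below and from above,
so the side tree is the same. -/
theorem child_top_false (i : Bool) (k : ℕ) :
    child moves (top i k) false = child moves (spine i (k + 1)) false := by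
  obtain ⟨n, rfl | rfl | rfl⟩ := eq_three_mul_add k
  · rw [top_three_mul, spine_three_mul_add_one]; rfl
  · rw [top_three_mul_add_one, spine_three_mul_add_two]; rfl
  · rw [top_three_mul_add_two, show 3 * n + 2 + 1 = 3 * (n + 1) by ring, spine_three_mul]; rfl

/-- The languages of the side trees along the spine. -/
def side (i : Bool) (k : ℕ) : Set (List Bool) := optLang (child moves (spine i k) false)

/-- The language at the start of the spine. -/
def base (i : Bool) : Set (List Bool) := lang (tree i 0)

theorem dropClosed_side (i : Bool) (k : ℕ) : DropClosed (side i k) := dropClosed_optLang _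

theorem dropClosed_base (i : Bool) : DropClosed (base i) := dropClosed_lang _

theorem lower_eq (i : Bool) (k : ℕ) : lower (base i) (side i) k = lang (spine i k) := by
  induction k with
  | zero => rfl
  | succ k ih => rw [lower, ih, lang_eq_node (spine i (k + 1)), child_spine_succ]; rfl

theorem upper_eq (i : Bool) (k : ℕ) : upper (side i) (k + 1) = lang (top i k) := by
  ext w
  induction w generalizing k with
  | nil => exact iff_of_true trivial rfl
  | cons b w ih =>
    rw [lang_eq_node, child_top_true, child_top_false]
    cases b with
    | true => exact ih (k + 1)
    | false => exact Iff.rfl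

theorem run_spine_replicate (d : Moves) (i : Bool) (k l : ℕ) (w : List Bool) :
    run d (spine i (k + l)) (List.replicate l true ++ w) = run d (spine i k) w := by
  induction l with
  | zero => rfl
  | succ l ih =>
    rw [List.replicate_succ, List.cons_append, run_cons, ← add_assoc, child_spine_succ]
    exact ih

/-- The types that occur in the trees. -/
def Valid : State → Prop
  | cone _ n => n ≠ 0
  | link _ n k => k ≤ 2 * n + 1
  | stem q => Valid q
  | cut q _ => Valid q
  | _ => True

theorem Valid.child {d : Moves} (hd : ∀ n p, d n = some p → Valid p.2) {q r : State} {b : Bool}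
    (hq : Valid q) (hr : child d q b = some r) : Valid r := by
  induction q generalizing b r with
  | leaf => cases b <;> simp [_root_.child] at hr
  | stem q =>
    cases b with
    | true => obtain rfl := Option.some.inj hr; exact hq
    | false => simp [_root_.child] at hr
  | tree i n =>
    cases n <;> cases b <;> simp only [_root_.child, Option.some.injEq, reduceCtorEq] at hr <;>
      subst hr <;> simp [Valid]
  | cone i n =>
    cases b <;> obtain rfl := Option.some.inj hr <;> simp [Valid]
  | link i n k =>
    cases b with
    | true =>
      cases k with
      | zero => obtain rfl := Option.some.inj hr; trivial
      | succ k =>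
        obtain rfl := Option.some.inj hr
        exact (Nat.le_succ k).trans hq
    | false =>
      simp only [_root_.child] at hr
      split_ifs at hr
      · obtain rfl := Option.some.inj hr; trivial
      · obtain ⟨p, hp, rfl⟩ := Option.map_eq_some_iff.1 hr
        exact hd _ _ hp
      · obtain rfl := Option.some.inj hr; trivial
  | tail i n =>
    cases b with
    | true =>
      simp only [_root_.child] at hr
      split_ifs at hr
      · obtain rfl := Option.some.inj hr; trivial
      · obtain ⟨p, hp, rfl⟩ := Option.map_eq_some_iff.1 hr
        trivial
    | false => obtain rfl := Option.some.inj hr; exact Nat.succ_ne_zero n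
  | cut q w ih =>
    rw [_root_.child] at hr
    split_ifs at hr
    · obtain ⟨p, hp, rfl⟩ := Option.map_eq_some_iff.1 hr
      exact (ih hq hp : Valid p)
    · exact ih hq hr

theorem Valid.run {d : Moves} (hd : ∀ n p, d n = some p → Valid p.2) {q r : State}
    {w : List Bool} (hq : Valid q) (hr : run d q w = some r) : Valid r := by
  induction w generalizing q with
  | nil => obtain rfl := Option.some.inj hr; exact hq
  | cons b w ih =>
    rw [run_cons, Option.bind_eq_some_iff] at hr
    obtain ⟨p, hp, hr⟩ := hr
    exact ih (hq.child hd hp) hr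

/-- The moved vertex is found by a run that uses earlier moves only, so strong induction applies.
Excluding `cone _ 0` and too large link indices matters later for embeddings. -/
theorem valid_moved (n : ℕ) : Valid (moved n) := by
  induction n using Nat.strong_induction_on with
  | _ n ih =>
    refine Valid.run (q := tree (active n) n) (fun m p hp => ?_) trivial (run_before_addr n)
    unfold Moves.before at hp
    split_ifs at hp with h
    obtain rfl := Option.some.inj hp
    exact ih m h

theorem valid_spine (i : Bool) (k : ℕ) : Valid (spine i k) := by
  obtain ⟨n, rfl | rfl | rfl⟩ := eq_three_mul_add k
  · rw [spine_three_mul]; trivial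
  · rw [spine_three_mul_add_one]; trivial
  · rw [spine_three_mul_add_two]; trivial

theorem Valid.run_moves {q r : State} {w : List Bool} (hq : Valid q)
    (hr : _root_.run moves q w = some r) : Valid r :=
  hq.run (fun n p hp => by obtain rfl := Option.some.inj hp; exact valid_moved n) hr

/-! ### Trees whose vertices have types -/

/-- A tree with a parent function whose vertices have types, in such a way that the children of a
vertex are determined by its type. -/
structure TypedTree (V : Type*) extends ParentTree V where
  type : V → State
  label : V → Bool
  child_par : ∀ x, child moves (type (par x)) (label x) = some (type x)
  exists_child : ∀ x b q, child moves (type x) b = some q → ∃ y, par y = x ∧ label y = b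
  valid : ∀ x, Valid (type x)
  eq_of_label : ∀ x y, par x = par y → label x = label y → x = y

theorem exists_rot_iterate_concat (x : List Bool ⊕ List Bool) :
    ∃ (p : ℕ × List Bool × Bool), rot^[p.1] x = .inl (p.2.1 ++ [p.2.2]) := by
  obtain ⟨k, w, h⟩ := exists_rot_iterate_eq_inl x
  -- One superfluous rotation makes the address nonempty, so that it has a last letter.
  have : true :: w ≠ [] := by simp
  refine ⟨(k + 1, (true :: w).dropLast, (true :: w).getLast this), ?_⟩
  rw [List.dropLast_append_getLast, Function.iterate_succ_apply', h]
  rfl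

theorem rot_iterate_injective (k : ℕ) : Function.Injective (rot^[k]) :=
  (EquivLike.injective rot).iterate k

/-- The type of the vertex `x` of the `i`-th tree. -/
noncomputable def typeAt (i : Bool) (x : List Bool ⊕ List Bool) : State :=
  let p := (exists_rot_iterate_concat x).choose
  (run moves (spine i p.1) (p.2.1 ++ [p.2.2])).getD leaf

/-- The last letter of the address of `x`. -/
noncomputable def labelAt (x : List Bool ⊕ List Bool) : Bool :=
  (exists_rot_iterate_concat x).choose.2.2

theorem eq_of_rot_iterate {x : List Bool ⊕ List Bool} {k l : ℕ} {u v : List Bool} (h : k ≤ l)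
    (hk : rot^[k] x = .inl u) (hl : rot^[l] x = .inl v) : v = List.replicate (l - k) true ++ u := by
  rw [← Nat.sub_add_cancel h, Function.iterate_add_apply, hk, rot_iterate_inl] at hl
  exact (Sum.inl.inj hl).symm

/-- Raising the level only prefixes letters `true`, which lead back down the spine. So `typeAt` does
not depend on the chosen coordinates. -/
theorem run_eq_of_rot_iterate {x : List Bool ⊕ List Bool} {k l : ℕ} {u v : List Bool} (i : Bool)
    (hk : rot^[k] x = .inl u) (hl : rot^[l] x = .inl v) :
    run moves (spine i k) u = run moves (spine i l) v := by
  rcases le_total k l with h | h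
  · rw [eq_of_rot_iterate h hk hl]
    have := run_spine_replicate moves i k (l - k) u
    rw [Nat.add_sub_cancel' h] at this
    exact this.symm
  · rw [eq_of_rot_iterate h hl hk]
    have := run_spine_replicate moves i l (k - l) v
    rw [Nat.add_sub_cancel' h] at this
    exact this

/-- The vertices of the `i`-th tree. -/
abbrev Vertex (i : Bool) : Type := SpineVertex (base i) (side i)

theorem run_typeAt {i : Bool} (x : Vertex i) {k : ℕ} {w : List Bool} (h : rot^[k] x.1 = .inl w) :
    run moves (spine i k) w = some (typeAt i x.1) := by
  have hm := (rot_iterate_mem_iff k x.1).2 x.2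
  rw [h, inl_mem_join, lower_eq, mem_lang, Option.isSome_iff_exists] at hm
  obtain ⟨q, hq⟩ := hm
  rw [typeAt, ← run_eq_of_rot_iterate i h (exists_rot_iterate_concat x.1).choose_spec, hq]
  rfl

theorem labelAt_eq {x : List Bool ⊕ List Bool} {k : ℕ} {w : List Bool} {b : Bool}
    (h : rot^[k] x = .inl (w ++ [b])) : labelAt x = b := by
  have h' := (exists_rot_iterate_concat x).choose_spec
  rcases le_total k (exists_rot_iterate_concat x).choose.1 with hkl | hkl
  · have := congrArg List.getLast? (eq_of_rot_iterate hkl h h')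
    simpa [labelAt, ← List.append_assoc] using this
  · have := congrArg List.getLast? (eq_of_rot_iterate hkl h' h)
    simpa [labelAt, ← List.append_assoc, eq_comm] using this

theorem exists_vertex {i : Bool} {k : ℕ} {w : List Bool} (h : w ∈ lang (spine i k)) :
    ∃ x : Vertex i, rot^[k] x.1 = .inl w := by
  obtain ⟨A, hA⟩ := exists_iso_eq_rot_iterate k
  have hr : rot^[k] (A.symm (.inl w)) = .inl w := by rw [← hA, RelIso.apply_symm_apply]
  refine ⟨⟨A.symm (.inl w), ?_⟩, hr⟩
  rw [← rot_iterate_mem_iff k, hr, inl_mem_join, lower_eq]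
  exact h

/-- The `i`-th tree. -/
noncomputable def typedTree (i : Bool) : TypedTree (Vertex i) where
  toParentTree := spineTree (base i) (side i) (dropClosed_base i) (dropClosed_side i)
  type x := typeAt i x.1
  label x := labelAt x.1
  child_par x := by
    obtain ⟨⟨k, w, b⟩, h⟩ := exists_rot_iterate_concat x.1
    have h' : rot^[k] (up x.1) = .inl w := by rw [rot_iterate_up, h]; exact up_iterate_inl w [b]
    have hr := run_typeAt x h
    rw [run_append, run_typeAt (spineTree (base i) (side i) (dropClosed_base i)
      (dropClosed_side i) |>.par x) h'] at hr
    rw [labelAt_eq h]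
    simpa using hr
  exists_child x b q hq := by
    obtain ⟨k, w, h⟩ := exists_rot_iterate_eq_inl x.1
    have hw : w ++ [b] ∈ lang (spine i k) := by
      rw [mem_lang, run_append, run_typeAt x h]
      simp [hq]
    obtain ⟨y, hy⟩ := exists_vertex hw
    refine ⟨y, Subtype.ext (rot_iterate_injective k ?_), labelAt_eq hy⟩
    change rot^[k] (up y.1) = _
    rw [rot_iterate_up, hy, h]
    exact up_iterate_inl w [b]
  valid x := by
    obtain ⟨k, w, h⟩ := exists_rot_iterate_eq_inl x.1
    exact (valid_spine i k).run_moves (run_typeAt x h)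
  eq_of_label x y hxy hl := by
    obtain ⟨k, w, h⟩ := exists_rot_iterate_eq_inl (up x.1)
    have h' : rot^[k] (up y.1) = .inl w := by
      rw [← h]; exact congrArg (fun z => rot^[k] z.1) hxy.symm
    rw [rot_iterate_up, up_eq_inl_iff] at h h'
    obtain ⟨b, hb⟩ := h
    obtain ⟨c, hc⟩ := h'
    rw [labelAt_eq hb, labelAt_eq hc] at hl
    rw [hl, ← hc] at hb
    exact Subtype.ext (rot_iterate_injective k hb)

/-- The first vertex of the spine. -/
def origin (i : Bool) : Vertex i := ⟨.inl [], rfl⟩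

theorem type_iterate_origin (i : Bool) (k : ℕ) :
    (typedTree i).type ((typedTree i).par^[k] (origin i)) = spine i k := by
  have h : rot^[k] ((typedTree i).par^[k] (origin i)).1 = .inl [] := by
    have hup : ∀ (j : ℕ) (y : List Bool ⊕ List Bool), rot^[k] (up^[j] y) = up^[j] (rot^[k] y) := by
      intro j
      induction j with
      | zero => exact fun _ => rfl
      | succ j ih =>
        intro y
        rw [Function.iterate_succ_apply, ih, rot_iterate_up, Function.iterate_succ_apply]
    have := coe_iterate_up (base i) (side i) (dropClosed_base i) (dropClosed_side i) k
      (origin i)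
    refine (congrArg _ this).trans ?_
    rw [hup, origin, rot_iterate_inl, List.append_nil]
    have := up_iterate_inl [] (List.replicate k true)
    rwa [List.length_replicate] at this
  exact (Option.some.inj (run_typeAt _ h)).symm

theorem exists_type_spine {i : Bool} (x : Vertex i) :
    ∃ K, ∀ k, K ≤ k → ∃ l, (typedTree i).type ((typedTree i).par^[k] x) = spine i l := by
  obtain ⟨K, L, h⟩ := (typedTree i).meet x (origin i)
  refine ⟨K, fun k hk => ⟨k - K + L, ?_⟩⟩
  rw [← Nat.sub_add_cancel hk, Function.iterate_add_apply, h, ← Function.iterate_add_apply,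
    Nat.add_sub_cancel, type_iterate_origin]

namespace TypedTree

variable {V : Type*} (P : TypedTree V)

theorem par_eq_or_of_adj {x y : V} (h : P.graph.Adj x y) : y = P.par x ∨ P.par y = x :=
  h.imp_left Eq.symm

theorem encard_neighborSet_le (x : V) : (P.graph.neighborSet x).encard ≤ 3 := by
  have h : P.graph.neighborSet x = insert (P.par x) {y | P.par y = x} :=
    Set.ext fun y => or_congr_left eq_comm
  rw [h]
  refine (Set.encard_insert_le _ _).trans ?_
  have : {y | P.par y = x}.encard ≤ (Set.univ : Set Bool).encard :=
    Set.encard_le_encard_of_injOn (f := P.label) (fun _ _ => trivial)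
      fun y hy z hz => P.eq_of_label y z (hy.trans hz.symm)
  rw [Set.encard_univ, ENat.card_eq_coe_fintype_card, Fintype.card_bool] at this
  exact (add_le_add_left this 1).trans (by norm_num)

theorem infinite (P : TypedTree V) [Nonempty V] : Infinite V :=
  Infinite.of_injective (fun k => P.par^[k] (Classical.arbitrary V)) fun _ _ h =>
    P.toParentTree.iterate_eq_iff.1 h

theorem exists_child_type {x : V} {b : Bool} {q : State} (h : child moves (P.type x) b = some q) :
    ∃ y, P.par y = x ∧ P.label y = b ∧ P.type y = q := by
  obtain ⟨y, rfl, rfl⟩ := P.exists_child x b q h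
  refine ⟨y, rfl, rfl, ?_⟩
  rw [P.child_par] at h
  exact Option.some.inj h

/-- If a vertex has three neighbours, then it has a child in each direction among them. -/
theorem exists_child_of_adj {x u v w : V} (hu : P.graph.Adj x u) (hv : P.graph.Adj x v)
    (hw : P.graph.Adj x w) (huv : u ≠ v) (huw : u ≠ w) (hvw : v ≠ w) (b : Bool) :
    ∃ y, P.par y = x ∧ P.label y = b ∧ (y = u ∨ y = v ∨ y = w) := by
  have key : ∀ y z, y ≠ z → P.par y = x → P.par z = x → P.label y = b ∨ P.label z = b := by
    intro y z hyz hy hz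
    have : P.label y ≠ P.label z := fun h => hyz (P.eq_of_label y z (hy.trans hz.symm) h)
    revert this
    cases P.label y <;> cases P.label z <;> cases b <;> simp
  rcases P.par_eq_or_of_adj hu with rfl | hu
  · have hv := (P.par_eq_or_of_adj hv).resolve_left huv.symm
    have hw := (P.par_eq_or_of_adj hw).resolve_left huw.symm
    rcases key v w hvw hv hw with h | h
    · exact ⟨v, hv, h, by simp⟩
    · exact ⟨w, hw, h, by simp⟩
  · rcases P.par_eq_or_of_adj hv with rfl | hv
    · have hw := (P.par_eq_or_of_adj hw).resolve_left hvw.symm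
      rcases key u w huw hu hw with h | h
      · exact ⟨u, hu, h, by simp⟩
      · exact ⟨w, hw, h, by simp⟩
    · rcases key u v huv hu hv with h | h
      · exact ⟨u, hu, h, by simp⟩
      · exact ⟨v, hv, h, by simp⟩

end TypedTree

/-- The `i`-th tree as a graph. -/
noncomputable abbrev graphOf (i : Bool) : SimpleGraph (Vertex i) := (typedTree i).graph

/-! ### Moving a vertex from one tree to the other -/

/-- The languages of the trees that hang from a link, apart from the moved one. -/
def pendant (i : Bool) (n k : ℕ) : Set (List Bool) :=
  if k = bif i then 0 else 2 * n + 1 then lang (stem leaf) else lang leaf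

/-- The trees that hang from a link, in the order of the link. -/
def pendants (i : Bool) (n : ℕ) : List (Set (List Bool)) :=
  (List.range (2 * n + 2)).reverse.map (pendant i n)

/-- The distinguished pendant has opposite indices in the two trees; all other pendants are leaves.
-/
theorem pendants_not (i : Bool) (n : ℕ) : pendants (!i) n = (pendants i n).reverse := by
  refine List.ext_getElem (by simp [pendants]) fun k h _ => ?_
  simp only [pendants, List.length_map, List.length_reverse, List.length_range] at h
  simp only [pendants, List.getElem_map, List.getElem_reverse, List.getElem_range,
    List.length_map, List.length_reverse, List.length_range, pendant]
  cases i <;> simp only [Bool.not_false, Bool.not_true, cond_true, cond_false] <;>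
    exact if_congr (by omega) rfl rfl

theorem child_link_false (i : Bool) (n k : ℕ) : child moves (link i n k) false =
    if k = bif i then 0 else 2 * n + 1 then
      if i = active n then some (stem leaf) else some (stem (stem (moved n)))
    else some leaf := by
  simp [child, moves_apply]

theorem lang_link_zero (i : Bool) (n : ℕ) : lang (link i n 0) =
    node (lang (tail i n)) (optLang (child moves (link i n 0) false)) := by
  rw [lang_eq_node, child, optLang_some]

theorem lang_link_succ (i : Bool) (n k : ℕ) : lang (link i n (k + 1)) =
    node (lang (link i n k)) (optLang (child moves (link i n (k + 1)) false)) := by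
  rw [lang_eq_node, child, optLang_some]

theorem chain_range_succ (f : ℕ → Set (List Bool)) (k : ℕ) (E : Set (List Bool)) :
    chain ((List.range (k + 1)).reverse.map f) E =
      node (chain ((List.range k).reverse.map f) E) (f k) := by
  rw [List.range_succ, List.reverse_append]
  rfl

theorem lang_link_of_forall (i : Bool) (n k : ℕ) (h : ∀ l, l ≤ k →
    optLang (child moves (link i n l) false) = pendant i n l) :
    lang (link i n k) = chain ((List.range (k + 1)).reverse.map (pendant i n))
      (lang (tail i n)) := by
  induction k with
  | zero => rw [lang_link_zero, h 0 le_rfl]; rfl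
  | succ k ih =>
    rw [lang_link_succ, ih fun l hl => h l (by omega), h _ le_rfl, chain_range_succ _ (k + 1)]

theorem lang_link_active (n : ℕ) : lang (link (active n) n (2 * n + 1)) =
    chain (pendants (active n) n) (lang (tail (active n) n)) := by
  refine lang_link_of_forall _ _ _ fun l _ => ?_
  rw [child_link_false, if_pos rfl, pendant, apply_ite optLang]
  rfl

theorem optLang_child_link_ne {i : Bool} {n k : ℕ} (h : k ≠ bif i then 0 else 2 * n + 1) :
    optLang (child moves (link i n k) false) = pendant i n k := by
  rw [child_link_false, pendant, if_neg h, if_neg h]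
  rfl

/-- Two stems with the moved subtree removed leave a path on two vertices. This is why the link of
the active tree carries `stem leaf` at that place. -/
theorem prune_optLang_child_link {n : ℕ} : prune (optLang (child moves
    (link (!active n) n (bif (!active n) then 0 else 2 * n + 1)) false)) [true, true] =
    pendant (!active n) n (bif (!active n) then 0 else 2 * n + 1) := by
  rw [child_link_false, pendant, if_pos rfl, if_pos rfl, if_neg (by simp), optLang_some,
    lang_stem, lang_stem, lang_stem, lang_leaf]
  simp

theorem prune_lang_link_true (n k : ℕ) (h : (!active n) = true) :
    prune (lang (link (!active n) n k)) (List.replicate k true ++ [false, true, true]) =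
      chain ((List.range (k + 1)).reverse.map (pendant (!active n) n))
        (lang (tail (!active n) n)) := by
  have hp := prune_optLang_child_link (n := n)
  rw [h] at hp ⊢
  induction k with
  | zero =>
    rw [lang_link_zero]
    exact (prune_node_false _ _ _).trans (congrArg _ hp)
  | succ k ih =>
    rw [lang_link_succ, chain_range_succ _ (k + 1), List.replicate_succ, List.cons_append,
      prune_node_true, ih, optLang_child_link_ne (by simp)]

theorem prune_lang_link (n : ℕ) :
    prune (lang (link (!active n) n (2 * n + 1)))
      (List.replicate (bif (!active n) then 2 * n + 1 else 0) true ++ [false, true, true]) =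
      chain (pendants (!active n) n) (lang (tail (!active n) n)) := by
  cases h : (!active n) with
  | true =>
    have := prune_lang_link_true n (2 * n + 1) h
    rwa [h] at this
  | false =>
    have hp := prune_optLang_child_link (n := n)
    rw [h] at hp
    simp only [cond_false, List.replicate_zero, List.nil_append] at hp ⊢
    rw [lang_link_succ, prune_node_false, hp, pendants, chain_range_succ _ (2 * n + 1),
      lang_link_of_forall false n (2 * n) fun l hl =>
        optLang_child_link_ne (by simp only [cond_false]; omega)]

/-- The address to which a vertex is moved in the `n`-th step. -/
noncomputable def target (n : ℕ) : List Bool :=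
  false :: (List.replicate (bif (!active n) then 2 * n + 1 else 0) true ++ [false, true, true])

theorem run_link_replicate (i : Bool) (n k l : ℕ) :
    run moves (link i n (k + l)) (List.replicate l true) = some (link i n k) := by
  induction l with
  | zero => rfl
  | succ l ih => exact ih

theorem run_target (n : ℕ) :
    run moves (tree (!active n) (n + 1)) (target n) = some (moved n) := by
  have h1 : child moves (link (!active n) n (bif (!active n) then 0 else 2 * n + 1)) false =
      some (stem (stem (moved n))) := by
    rw [child_link_false, if_pos rfl, if_neg (by simp)]
  have h2 : run moves (link (!active n) n (2 * n + 1))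
      (List.replicate (bif (!active n) then 2 * n + 1 else 0) true) =
      some (link (!active n) n (bif (!active n) then 0 else 2 * n + 1)) := by
    cases (!active n)
    · rfl
    · have := run_link_replicate true n 0 (2 * n + 1)
      rwa [zero_add] at this
  change run moves (link (!active n) n (2 * n + 1)) (_ ++ _) = _
  rw [run_append, h2, Option.bind_some, run_cons, h1]
  rfl

/-- After removal of the moved subtree both trees have the same link with the same four parts at its
ends; the joining edge merely lies in different parts and has to be transported along the link. -/
theorem joinEquiv_step (n : ℕ) :
    JoinEquiv (prune (lang (tree (active n) n)) (addr n)) (lang (top (active n) (3 * n)))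
      (prune (lang (tree (!active n) (n + 1))) (target n))
      (lang (top (!active n) (3 * (n + 1)))) := by
  have e1 : lang (top (active n) (3 * n)) = node (node (node
      (lang (stem (stem (cone (active n) (n + 1))))) (chain (pendants (active n) n)
        (node (lang (stem (stem (tree (!active n) n))))
          (lang (stem (stem (cone (!active n) (n + 1)))))))) ∅) ∅ := by
    have : lang (tail (active n) n) = node (lang (stem (stem (tree (!active n) n))))
          (lang (stem (stem (cone (!active n) (n + 1))))) := by
      rw [lang_eq_node]; simp [child]
    rw [top_three_mul, lang_stem, lang_stem, lang_eq_node (cone (active n) n), child, child,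
      optLang_some, optLang_some, lang_link_active, this]
  have e2 : prune (lang (tree (!active n) (n + 1))) (target n) =
      node (lang (stem (stem (tree (!active n) n)))) (chain (pendants (active n) n).reverse
        (node (node (node (prune (lang (tree (active n) n)) (addr n)) ∅) ∅)
          (lang (stem (stem (cone (active n) (n + 1))))))) := by
    have : lang (tail (!active n) n) =
        node (node (node (prune (lang (tree (active n) n)) (addr n)) ∅) ∅)
          (lang (stem (stem (cone (active n) (n + 1))))) := by
      rw [← lang_cut _ (addr_ne_nil n), ← lang_stem, ← lang_stem, lang_eq_node]
      simp [child, moves_apply]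
    rw [lang_tree_succ, target, prune_node_false, prune_lang_link, pendants_not, this]
  rw [e1, e2, top_three_mul]
  -- Two rotations pass the stems, one passes the near end of the link after its branches are
  -- swapped, `JoinEquiv.chain` runs along the link, and one more rotation enters the upward part of
  -- the other tree. The last three moves only swap children on the left.
  refine (JoinEquiv.rot _ _ _).trans <| (JoinEquiv.rot _ _ _).trans <|
    (JoinEquiv.swap _ _ _).trans <| (JoinEquiv.rot _ _ _).trans <|
    (JoinEquiv.chain _ _ _).trans <| (JoinEquiv.swap _ _ _).trans <|
    (JoinEquiv.rot _ _ _).trans <| (JoinEquiv.comm _ _).trans <|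
    (JoinEquiv.swap _ _ _).trans (JoinEquiv.comm _ _)

theorem exists_exchangeable {n : ℕ} {i j : Bool} (hi : active n = i) (hj : (!i) = j) {x : Vertex i}
    (hx : rot^[3 * n] x.1 = .inl (addr n)) :
    ∃ y : Vertex j, rot^[3 * (n + 1)] y.1 = .inl (target n) ∧
      (typedTree i).Exchangeable (typedTree j).toParentTree x y := by
  subst hi hj
  have ht := run_target n
  have ha := run_addr n
  rw [← spine_three_mul] at ht ha
  obtain ⟨y, hy⟩ := exists_vertex (i := !active n) (k := 3 * (n + 1)) (w := target n)
    (by rw [mem_lang, ht]; rfl)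
  refine ⟨y, hy, spineTree_exchangeable (hb := dropClosed_base _) (hs := dropClosed_side _)
    (hb' := dropClosed_base _) (hs' := dropClosed_side _) hx hy (fun v => ?_) ?_⟩
  · rw [lower_eq, lower_eq, mem_lang, mem_lang, run_append, run_append, ht, ha]
  · rw [lower_eq, lower_eq, upper_eq, upper_eq, spine_three_mul, spine_three_mul]
    exact joinEquiv_step n

/-- The schedule returns to the coordinates of `x` arbitrarily late, in particular at steps at which
`x` is already visible and lies below the spine vertex `3 * n` without being it. -/
theorem exists_addr_eq {i : Bool} (x : Vertex i) (N : ℕ) :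
    ∃ n, N ≤ n ∧ active n = i ∧ rot^[3 * n] x.1 = .inl (addr n) := by
  obtain ⟨k, w, h⟩ := exists_rot_iterate_eq_inl x.1
  obtain ⟨M, hM⟩ := exists_run_before (run_typeAt x h)
  obtain ⟨n, hn, hs⟩ := schedule_spec (i, k, w) (max N (max M (k + 1)))
  have h1 : N ≤ n := le_trans (le_max_left _ _) hn
  have h2 : M ≤ n := le_trans (le_trans (le_max_left _ _) (le_max_right _ _)) hn
  have h3 : k + 1 ≤ n := le_trans (le_trans (le_max_right _ _) (le_max_right _ _)) hn
  have hi : active n = i := by rw [active, hs]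
  have hc : candidate n = List.replicate (3 * n - k) true ++ w := by rw [candidate, hs]
  have ha : addr n = candidate n := by
    refine addr_eq_candidate (r := typeAt i x.1) ?_ ?_
    · rw [hc, show 3 * n - k = (3 * n - k - 1) + 1 by omega]
      simp [List.replicate_succ]
    · rw [hc, hi, ← spine_three_mul, show 3 * n = k + (3 * n - k) by omega,
        Nat.add_sub_cancel_left, run_spine_replicate]
      exact run_mono (moves.before_mono h2) hM
  refine ⟨n, h1, hi, ?_⟩
  rw [ha, hc, ← rot_iterate_inl, ← h, ← Function.iterate_add_apply,
    Nat.sub_add_cancel (by omega)]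

theorem infinite_exchangeable {i j : Bool} (hj : (!i) = j) (x : Vertex i) :
    {y | (typedTree i).Exchangeable (typedTree j).toParentTree x y}.Infinite := by
  let s : Set ℕ := {n | active n = i ∧ rot^[3 * n] x.1 = .inl (addr n)}
  have hs : s.Infinite := Set.infinite_of_forall_exists_gt fun N => by
    obtain ⟨n, h1, h2⟩ := exists_addr_eq x (N + 1)
    exact ⟨n, h2, h1⟩
  have : ∀ n, ∃ y : Vertex j, n ∈ s → rot^[3 * (n + 1)] y.1 = .inl (target n) ∧
      (typedTree i).Exchangeable (typedTree j).toParentTree x y := by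
    intro n
    by_cases hn : n ∈ s
    · exact (exists_exchangeable hn.1 hj hn.2).imp fun y hy _ => hy
    · exact ⟨origin j, fun h => absurd h hn⟩
  choose f hf using this
  have key : ∀ m n, m < n → m ∈ s → n ∈ s → f m ≠ f n := by
    intro m n hmn hm hn h
    have h1 := (hf m hm).1
    have h2 := (hf n hn).1
    rw [h] at h1
    -- A vertex with an address at level `3 * (m + 1)` has one starting with `true` at any higher
    -- level, but `target n` starts with `false`. So different steps give different partners.
    have := eq_of_rot_iterate (by omega) h1 h2
    rw [show 3 * (n + 1) - 3 * (m + 1) = (3 * (n + 1) - 3 * (m + 1) - 1) + 1 by omega] at this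
    simp [target, List.replicate_succ] at this
  refine Set.infinite_of_injOn_mapsTo (f := f) (s := s) (fun m hm n hn h => ?_)
    (fun n hn => (hf n hn).2) hs
  rcases lt_trichotomy m n with hmn | hmn | hmn
  · exact absurd h (key m n hmn hm hn)
  · exact hmn
  · exact absurd h.symm (key n m hmn hn hm)

theorem exists_hypomorphism : ∃ φ : Vertex false ≃ Vertex true, ∀ x,
    (typedTree false).Exchangeable (typedTree true).toParentTree x (φ x) := by
  refine ParentTree.exists_equiv_exchangeable (infinite_exchangeable rfl) fun y => ?_
  refine (infinite_exchangeable (i := true) rfl y).mono fun x hx => hx.symm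

/-! ### Cuttings and positions on links -/

/-- The type `q` is obtained from `r` by removing subtrees. -/
inductive Cutting : State → State → Prop
  | refl (q : State) : Cutting q q
  | cut {q r : State} (w : List Bool) (h : Cutting q r) : Cutting (cut q w) r

/-- The type from which `q` is obtained by removing subtrees. -/
def core : State → State
  | cut q _ => core q
  | q => q

theorem cutting_core (q : State) : Cutting q (core q) := by
  induction q with
  | cut q w ih => exact ih.cut w
  | _ => exact .refl _

theorem Cutting.core_eq {q r : State} (h : Cutting q r) : core q = core r := by
  induction h with
  | refl => rfl
  | cut w h ih => exact ih

theorem Cutting.child {q r q' : State} {b : Bool} (h : Cutting q r)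
    (hq : child moves q b = some q') : ∃ r', child moves r b = some r' ∧ Cutting q' r' := by
  induction h generalizing q' with
  | refl => exact ⟨q', hq, .refl q'⟩
  | cut w h ih =>
    rw [_root_.child] at hq
    split_ifs at hq
    · obtain ⟨p, hp, rfl⟩ := Option.map_eq_some_iff.1 hq
      obtain ⟨r', h1, h2⟩ := ih hp
      exact ⟨r', h1, h2.cut _⟩
    · exact ih hq

theorem Cutting.run {q r q' : State} {w : List Bool} (h : Cutting q r)
    (hq : run moves q w = some q') : ∃ r', run moves r w = some r' ∧ Cutting q' r' := by
  induction w generalizing q r with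
  | nil => obtain rfl := Option.some.inj hq; exact ⟨r, rfl, h⟩
  | cons b w ih =>
    rw [run_cons, Option.bind_eq_some_iff] at hq
    obtain ⟨p, hp, hq⟩ := hq
    obtain ⟨r', h1, h2⟩ := h.child hp
    obtain ⟨r'', h3, h4⟩ := ih h2 hq
    exact ⟨r'', by rw [run_cons, h1]; exact h3, h4⟩

theorem Cutting.lang_subset {q r : State} (h : Cutting q r) : lang q ⊆ lang r := fun w hw => by
  obtain ⟨q', hq⟩ := Option.isSome_iff_exists.1 hw
  obtain ⟨r', hr, -⟩ := h.run hq
  rw [mem_lang, hr]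
  rfl

/-- The position of a vertex with two children on the link it belongs to: the level of the link, the
tree in which it is attached, and the place on the link. -/
def place : State → Option (ℕ × Bool × ℤ)
  | tree i (n + 1) => some (n, i, bif i then 2 * n + 3 else 0)
  | cone i n => some (n, i, bif i then 2 * n + 3 else 0)
  | link i n k => some (n, i, bif i then (k : ℤ) + 1 else 2 * n + 2 - k)
  | tail i n => some (n, i, bif i then 0 else 2 * n + 3)
  | _ => none

/-- Up to cutting, the only types with two children are those of link vertices, ends included. -/
theorem exists_place_core {q r r' : State} (h : child moves (core q) true = some r)
    (h' : child moves (core q) false = some r') : ∃ p, place (core q) = some p := by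
  induction q with
  | leaf => simp [core, child] at h
  | stem => simp [core, child] at h'
  | tree i n =>
    cases n with
    | zero => simp [core, child] at h'
    | succ n => exact ⟨_, rfl⟩
  | cone => exact ⟨_, rfl⟩
  | link => exact ⟨_, rfl⟩
  | tail => exact ⟨_, rfl⟩
  | cut q w ih => exact ih h h'

theorem place_child_link_false {i : Bool} {n k : ℕ} {r : State}
    (h : child moves (link i n k) false = some r) : place (core r) = none := by
  rw [child_link_false] at h
  split_ifs at h <;> obtain rfl := Option.some.inj h <;> rfl

theorem place_child_tail {i : Bool} {n : ℕ} {b : Bool} {r : State}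
    (h : child moves (tail i n) b = some r) : place (core r) = none := by
  cases b with
  | false => obtain rfl := Option.some.inj h; rfl
  | true =>
    simp only [child, moves_apply, Option.map_some] at h
    split_ifs at h <;> obtain rfl := Option.some.inj h <;> rfl

/-- The direction in which a link continues. -/
def onward : State → Bool
  | link _ _ _ => true
  | _ => false

/-- Everything attached to a link is a leaf or begins with a stem, and neither has a place. So a
child with a place is the next vertex of the same link. -/
theorem place_child {q r : State} {b i j : Bool} {n m : ℕ} {s t : ℤ} (hr : child moves q b = some r)
    (hq : place q = some (n, i, s)) (hr' : place (core r) = some (m, j, t)) :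
    m = n ∧ j = i ∧ t = s + (bif i then -1 else 1) ∧ b = onward q := by
  cases q with
  | leaf => simp [place] at hq
  | stem => simp [place] at hq
  | cut => simp [place] at hq
  | tail => rw [place_child_tail hr] at hr'; simp at hr'
  | tree i' n' =>
    cases n' with
    | zero => simp [place] at hq
    | succ n' =>
      cases b <;> obtain rfl := Option.some.inj hr
      · simp only [place, core, Option.some.injEq, Prod.mk.injEq] at hq hr'
        obtain ⟨rfl, rfl, rfl⟩ := hq
        obtain ⟨rfl, rfl, rfl⟩ := hr'
        refine ⟨rfl, rfl, ?_, rfl⟩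
        cases i' <;> push_cast <;> simp <;> ring
      · simp [place, core] at hr'
  | cone i' n' =>
    cases b <;> obtain rfl := Option.some.inj hr
    · simp only [place, core, Option.some.injEq, Prod.mk.injEq] at hq hr'
      obtain ⟨rfl, rfl, rfl⟩ := hq
      obtain ⟨rfl, rfl, rfl⟩ := hr'
      refine ⟨rfl, rfl, ?_, rfl⟩
      cases i' <;> push_cast <;> simp <;> ring
    · simp [place, core] at hr'
  | link i' n' k =>
    cases b with
    | false => rw [place_child_link_false hr] at hr'; simp at hr'
    | true =>
      cases k <;> obtain rfl := Option.some.inj hr <;>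
        simp only [place, core, Option.some.injEq, Prod.mk.injEq] at hq hr' <;>
        obtain ⟨rfl, rfl, rfl⟩ := hq <;> obtain ⟨rfl, rfl, rfl⟩ := hr' <;>
        refine ⟨rfl, rfl, ?_, rfl⟩ <;> cases i' <;> push_cast <;> simp <;> ring

theorem Valid.core {q : State} (h : Valid q) : Valid (core q) := by
  induction q with
  | cut q w ih => exact ih h
  | _ => exact h

theorem eq_link_of_place {q : State} {i : Bool} {n : ℕ} {s : ℤ} (h : place q = some (n, i, s))
    (h0 : s ≠ 0) (h1 : s ≠ 2 * n + 3) :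
    ∃ k : ℕ, q = link i n k ∧ s = bif i then (k : ℤ) + 1 else 2 * n + 2 - k := by
  cases q with
  | leaf => simp [place] at h
  | stem => simp [place] at h
  | cut => simp [place] at h
  | tree i' n' =>
    cases n' with
    | zero => simp [place] at h
    | succ n' =>
      simp only [place, Option.some.injEq, Prod.mk.injEq] at h
      obtain ⟨rfl, rfl, rfl⟩ := h
      cases i' <;> simp at h0 h1
  | cone i' n' =>
    simp only [place, Option.some.injEq, Prod.mk.injEq] at h
    obtain ⟨rfl, rfl, rfl⟩ := h
    cases i' <;> simp at h0 h1
  | tail i' n' =>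
    simp only [place, Option.some.injEq, Prod.mk.injEq] at h
    obtain ⟨rfl, rfl, rfl⟩ := h
    cases i' <;> simp at h0 h1
  | link i' n' k =>
    simp only [place, Option.some.injEq, Prod.mk.injEq] at h
    obtain ⟨rfl, rfl, rfl⟩ := h
    exact ⟨k, rfl, rfl⟩

/-- The trees that hang from a link are trivial with the exception of one at place `1`. -/
theorem place_eq_one_of_child {i : Bool} {n k : ℕ} {r r' : State} {b : Bool}
    (h : child moves (link i n k) false = some r) (h' : child moves r b = some r') :
    k = bif i then 0 else 2 * n + 1 := by
  rw [child_link_false] at h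
  by_contra hk
  rw [if_neg hk] at h
  obtain rfl := Option.some.inj h
  cases b <;> simp [child] at h'

theorem ne_active_of_child {i : Bool} {n k : ℕ} {r r' r'' : State} {b c : Bool}
    (h : child moves (link i n k) false = some r) (h' : child moves r b = some r')
    (h'' : child moves r' c = some r'') : i ≠ active n := by
  intro hi
  have hk := place_eq_one_of_child h h'
  rw [child_link_false, if_pos hk, if_pos hi] at h
  obtain rfl := Option.some.inj h
  cases b with
  | false => simp [child] at h'
  | true =>
    obtain rfl := Option.some.inj h'
    cases c <;> simp [child] at h''

theorem eq_tail_of_place {q : State} {i : Bool} {n : ℕ}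
    (h : place q = some (n, !i, bif i then 2 * (n : ℤ) + 3 else 0)) : q = tail (!i) n := by
  cases q with
  | leaf => simp [place] at h
  | stem => simp [place] at h
  | cut => simp [place] at h
  | tree i' n' =>
    cases n' with
    | zero => simp [place] at h
    | succ n' =>
      simp only [place, Option.some.injEq, Prod.mk.injEq] at h
      obtain ⟨rfl, rfl, h⟩ := h
      cases i <;> simp at h <;> omega
  | cone i' n' =>
    simp only [place, Option.some.injEq, Prod.mk.injEq] at h
    obtain ⟨rfl, rfl, h⟩ := h
    cases i <;> simp at h <;> omega
  | tail i' n' =>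
    simp only [place, Option.some.injEq, Prod.mk.injEq] at h
    rw [h.1, h.2.1]
  | link i' n' k =>
    simp only [place, Option.some.injEq, Prod.mk.injEq] at h
    obtain ⟨rfl, rfl, h⟩ := h
    cases i <;> simp at h <;> omega

theorem eq_tree_or_cone_of_place {q : State} {i : Bool} {n : ℕ} (hq : Valid q)
    (h : place q = some (n, i, bif i then 2 * (n : ℤ) + 3 else 0)) :
    q = tree i (n + 1) ∨ q = cone i n := by
  cases q with
  | leaf => simp [place] at h
  | stem => simp [place] at h
  | cut => simp [place] at h
  | tree i' n' =>
    cases n' with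
    | zero => simp [place] at h
    | succ n' =>
      simp only [place, Option.some.injEq, Prod.mk.injEq] at h
      exact .inl (by rw [h.1, h.2.1])
  | cone i' n' =>
    simp only [place, Option.some.injEq, Prod.mk.injEq] at h
    exact .inr (by rw [h.1, h.2.1])
  | tail i' n' =>
    simp only [place, Option.some.injEq, Prod.mk.injEq] at h
    obtain ⟨rfl, rfl, h⟩ := h
    cases i' <;> simp at h <;> omega
  | link i' n' k =>
    simp only [place, Option.some.injEq, Prod.mk.injEq] at h
    obtain ⟨rfl, rfl, h⟩ := h
    have hk : k ≤ 2 * n' + 1 := hq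
    cases i' <;> simp at h <;> omega

/-- A vertex with a child of type `tree i n` is a stem. -/
theorem eq_stem_of_child_tree {q r : State} {b i : Bool} {n : ℕ}
    (h : child moves (core q) b = some r) (hr : core r = tree i (n + 1)) :
    ∃ q', core q = stem q' ∧ core q' = tree i (n + 1) := by
  induction q with
  | leaf => cases b <;> simp [core, child] at h
  | stem q =>
    cases b with
    | false => simp [core, child] at h
    | true => obtain rfl := Option.some.inj h; exact ⟨q, rfl, hr⟩
  | tree i' n' =>
    cases n' <;> cases b <;> simp only [core, child, Option.some.injEq, reduceCtorEq] at h <;>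
      subst h <;> simp [core] at hr
  | cone i' n' => cases b <;> obtain rfl := Option.some.inj h <;> simp [core] at hr
  | tail i' n' =>
    cases b with
    | false => obtain rfl := Option.some.inj h; simp [core] at hr
    | true =>
      simp only [core, child, moves_apply, Option.map_some] at h
      split_ifs at h <;> obtain rfl := Option.some.inj h <;> simp [core] at hr
  | link i' n' k =>
    cases b with
    | true => cases k <;> obtain rfl := Option.some.inj h <;> simp [core] at hr
    | false =>
      change child moves (link i' n' k) false = some r at h
      rw [child_link_false] at h
      split_ifs at h <;> obtain rfl := Option.some.inj h <;> simp [core] at hr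
  | cut q w ih => exact ih h

/-- A vertex with a child of type `stem q`, where `q` is of type `tree i n`, is a stem. -/
theorem eq_stem_of_child_stem_tree {q r s : State} {b i : Bool} {n : ℕ}
    (h : child moves (core q) b = some r) (hr : core r = stem s) (hs : core s = tree i (n + 1)) :
    ∃ q', core q = stem q' ∧ core q' = stem s := by
  induction q with
  | leaf => cases b <;> simp [core, child] at h
  | stem q =>
    cases b with
    | false => simp [core, child] at h
    | true => obtain rfl := Option.some.inj h; exact ⟨q, rfl, hr⟩
  | tree i' n' =>
    cases n' <;> cases b <;> simp only [core, child, Option.some.injEq, reduceCtorEq] at h <;>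
      subst h <;> simp [core] at hr <;> subst hr <;> simp [core] at hs
  | cone i' n' =>
    cases b <;> obtain rfl := Option.some.inj h <;> simp [core] at hr <;> subst hr <;>
      simp [core] at hs
  | tail i' n' =>
    cases b with
    | false => obtain rfl := Option.some.inj h; simp [core] at hr; subst hr; simp [core] at hs
    | true =>
      simp only [core, child, moves_apply, Option.map_some] at h
      split_ifs at h <;> obtain rfl := Option.some.inj h <;> simp [core] at hr <;> subst hr <;>
        simp [core] at hs
  | link i' n' k =>
    cases b with
    | true => cases k <;> obtain rfl := Option.some.inj h <;> simp [core] at hr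
    | false =>
      change child moves (link i' n' k) false = some r at h
      rw [child_link_false] at h
      split_ifs at h <;> obtain rfl := Option.some.inj h <;> simp [core] at hr <;> subst hr <;>
        simp [core] at hs
  | cut q w ih => exact ih h

/-- From a cone, two stems lead to another cone and the remaining child is a link; no `tree` is
reached through two stems. -/
theorem cone_child_ne {i j : Bool} {n m : ℕ} {b : Bool} {r q s : State}
    (h : child moves (cone i n) b = some r) (hr : core r = stem q) (hq : core q = stem s)
    (hs : core s = tree j m) : False := by
  cases b <;> obtain rfl := Option.some.inj h
  · simp [core] at hr
  · simp only [core, stem.injEq] at hr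
    subst hr
    simp only [core, stem.injEq] at hq
    subst hq
    simp [core] at hs

/-! ### Embeddings -/

namespace TypedTree

variable {V W : Type*} {P : TypedTree V} {Q : TypedTree W}

theorem exists_core_child (Q : TypedTree W) {x : W} {q : State} (h : Cutting (Q.type (Q.par x)) q) :
    ∃ r, child moves q (Q.label x) = some r ∧ Cutting (Q.type x) r :=
  h.child (Q.child_par x)

/-- The position of a vertex. -/
def placeOf (Q : TypedTree W) (x : W) : Option (ℕ × Bool × ℤ) := place (core (Q.type x))

theorem placeOf_par {x : W} {n m : ℕ} {i j : Bool} {s t : ℤ}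
    (hx : Q.placeOf (Q.par x) = some (n, i, s)) (hy : Q.placeOf x = some (m, j, t)) :
    m = n ∧ j = i ∧ t = s + (bif i then -1 else 1) ∧
      Q.label x = onward (core (Q.type (Q.par x))) := by
  obtain ⟨r, h1, h2⟩ := Q.exists_core_child (x := x) (cutting_core _)
  rw [placeOf, h2.core_eq] at hy
  exact place_child h1 hx hy

theorem placeOf_adj {x y : W} {n m : ℕ} {i j : Bool} {s t : ℤ} (h : Q.graph.Adj x y)
    (hx : Q.placeOf x = some (n, i, s)) (hy : Q.placeOf y = some (m, j, t)) :
    m = n ∧ j = i ∧ (t = s + 1 ∨ t = s - 1) := by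
  rcases Q.par_eq_or_of_adj h with rfl | rfl
  · obtain ⟨rfl, rfl, rfl, -⟩ := placeOf_par hy hx
    exact ⟨rfl, rfl, by cases i <;> simp⟩
  · obtain ⟨rfl, rfl, rfl, -⟩ := placeOf_par hx hy
    exact ⟨rfl, rfl, by cases j <;> simp; rfl⟩

/-- A vertex of a link has at most one child with a place, and such a child lies opposite to a
parent with a place. -/
theorem placeOf_ne {x y z : W} {n m l : ℕ} {i j k : Bool} {s t u : ℤ} (hxy : Q.graph.Adj x y)
    (hxz : Q.graph.Adj x z) (hne : y ≠ z) (hx : Q.placeOf x = some (n, i, s))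
    (hy : Q.placeOf y = some (m, j, t)) (hz : Q.placeOf z = some (l, k, u)) : t ≠ u := by
  rcases Q.par_eq_or_of_adj hxy with rfl | rfl <;> rcases Q.par_eq_or_of_adj hxz with h | h
  · exact absurd h.symm hne
  · subst h
    obtain ⟨rfl, rfl, rfl, -⟩ := placeOf_par hy hx
    obtain ⟨rfl, rfl, rfl, -⟩ := placeOf_par hx hz
    cases k <;> simp <;> omega
  · subst h
    obtain ⟨rfl, rfl, rfl, -⟩ := placeOf_par hz hx
    obtain ⟨rfl, rfl, rfl, -⟩ := placeOf_par hx hy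
    cases j <;> simp <;> omega
  · have h1 := placeOf_par hx hy
    rw [← h] at hx
    have h2 := placeOf_par hx hz
    refine absurd (Q.eq_of_label y z h.symm ?_) hne
    rw [h1.2.2.2, h2.2.2.2, h]

/-- At most one of three neighbours is the parent, so the type has children in both directions, also
before cutting. -/
theorem exists_placeOf {x u v w : W} (hu : Q.graph.Adj x u) (hv : Q.graph.Adj x v)
    (hw : Q.graph.Adj x w) (huv : u ≠ v) (huw : u ≠ w) (hvw : v ≠ w) :
    ∃ p, Q.placeOf x = some p := by
  obtain ⟨y, rfl, hy, -⟩ := Q.exists_child_of_adj hu hv hw huv huw hvw true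
  obtain ⟨z, hz, hz', -⟩ := Q.exists_child_of_adj hu hv hw huv huw hvw false
  obtain ⟨r, h1, -⟩ := Q.exists_core_child (x := y) (cutting_core _)
  obtain ⟨r', h2, -⟩ := Q.exists_core_child (x := z) (cutting_core _)
  rw [hy] at h1
  rw [hz', hz] at h2
  exact exists_place_core h1 h2

/-- A walk of length `2` starts at `x` with the edge to `u`. -/
def Path2 (P : TypedTree V) (x u : V) : Prop :=
  P.graph.Adj x u ∧ ∃ u', P.graph.Adj u u' ∧ u' ≠ x

/-- A walk of length `3` starts at `x` with the edge to `u`. -/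
def Path3 (P : TypedTree V) (x u : V) : Prop :=
  P.graph.Adj x u ∧ ∃ u' u'', P.graph.Adj u u' ∧ u' ≠ x ∧ P.graph.Adj u' u'' ∧ u'' ≠ u

theorem Path3.path2 {x u : V} (h : P.Path3 x u) : P.Path2 x u := by
  obtain ⟨h1, u', u'', h2, h3, -⟩ := h
  exact ⟨h1, u', h2, h3⟩

theorem Path2.exists_child {y : W} {r : State} (h : Q.Path2 (Q.par y) y)
    (hr : Cutting (Q.type y) r) : ∃ b r', child moves r b = some r' := by
  obtain ⟨-, z, hz, hzx⟩ := h
  obtain rfl := (Q.par_eq_or_of_adj hz).resolve_left hzx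
  obtain ⟨r', hr', -⟩ := Q.exists_core_child hr
  exact ⟨_, r', hr'⟩

theorem Path3.exists_child {y : W} {r : State} (h : Q.Path3 (Q.par y) y)
    (hr : Cutting (Q.type y) r) :
    ∃ b r' c r'', child moves r b = some r' ∧ child moves r' c = some r'' := by
  obtain ⟨-, z, z', hz, hzx, hz', hne⟩ := h
  obtain rfl := (Q.par_eq_or_of_adj hz).resolve_left hzx
  obtain rfl := (Q.par_eq_or_of_adj hz').resolve_left hne
  obtain ⟨r', hr', hc⟩ := Q.exists_core_child hr
  obtain ⟨r'', hr'', -⟩ := Q.exists_core_child hc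
  exact ⟨_, r', _, r'', hr', hr''⟩

/-- One of the neighbours of an inner vertex of a link is the pendant one. -/
theorem exists_pendant {x u v w : W} {n : ℕ} {i : Bool} {s : ℤ}
    (hx : Q.placeOf x = some (n, i, s)) (h0 : s ≠ 0) (h1 : s ≠ 2 * n + 3) (hu : Q.graph.Adj x u)
    (hv : Q.graph.Adj x v) (hw : Q.graph.Adj x w) (hu' : ∃ p, Q.placeOf u = some p)
    (huv : u ≠ v) (huw : u ≠ w) (hvw : v ≠ w) :
    ∃ (k : ℕ) (y : W) (r : State), (k = (bif i then 0 else 2 * n + 1) → s = 1) ∧ Q.par y = x ∧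
      child moves (link i n k) false = some r ∧ Cutting (Q.type y) r ∧ Q.placeOf y = none ∧
      (y = v ∨ y = w) := by
  obtain ⟨k, hq, hs⟩ := eq_link_of_place hx h0 h1
  obtain ⟨y, hy, hl, hyu⟩ := Q.exists_child_of_adj hu hv hw huv huw hvw false
  have hc := cutting_core (Q.type x)
  rw [hq, ← hy] at hc
  obtain ⟨r, hr, hc'⟩ := Q.exists_core_child hc
  rw [hl] at hr
  have hn : Q.placeOf y = none := by
    rw [placeOf, hc'.core_eq]; exact place_child_link_false hr
  refine ⟨k, y, r, fun hk => ?_, hy, hr, hc', hn, hyu.resolve_left ?_⟩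
  · rw [hs, hk]
    cases i <;> simp
  · rintro rfl
    rw [hn] at hu'
    simp at hu'

/-- The neighbour `u` has a place, so the pendant of `x` is `v` or `w`. It extends further, and only
the pendant at place `1` is more than a leaf. -/
theorem placeOf_eq_one_of_path2 {x u v w : W} {n : ℕ} {i : Bool} {s : ℤ}
    (hx : Q.placeOf x = some (n, i, s)) (h0 : s ≠ 0) (h1 : s ≠ 2 * n + 3) (hu : Q.graph.Adj x u)
    (hv : Q.Path2 x v) (hw : Q.Path2 x w) (hu' : ∃ p, Q.placeOf u = some p)
    (huv : u ≠ v) (huw : u ≠ w) (hvw : v ≠ w) : s = 1 := by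
  obtain ⟨k, y, r, hk, rfl, hr, hc, -, hy⟩ := exists_pendant hx h0 h1 hu hv.1 hw.1 hu' huv huw hvw
  have hp : Q.Path2 (Q.par y) y := by rcases hy with rfl | rfl <;> assumption
  obtain ⟨b, r', hr'⟩ := hp.exists_child hc
  exact hk (place_eq_one_of_child hr hr')

theorem placeOf_eq_one {x u v w : W} {n : ℕ} {i : Bool} {s : ℤ}
    (hx : Q.placeOf x = some (n, i, s)) (h0 : s ≠ 0) (h1 : s ≠ 2 * n + 3) (hu : Q.graph.Adj x u)
    (hv : Q.Path2 x v) (hw : Q.graph.Adj x w) (hu' : ∃ p, Q.placeOf u = some p)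
    (hw' : ∃ p, Q.placeOf w = some p) (huv : u ≠ v) (huw : u ≠ w) (hvw : v ≠ w) : s = 1 := by
  obtain ⟨k, y, r, hk, rfl, hr, hc, hn, hy⟩ := exists_pendant hx h0 h1 hu hv.1 hw hu' huv huw hvw
  obtain rfl := hy.resolve_right (by rintro rfl; rw [hn] at hw'; simp at hw')
  obtain ⟨b, r', hr'⟩ := hv.exists_child hc
  exact hk (place_eq_one_of_child hr hr')

/-- A pendant that continues for three steps must contain a moved subtree, which the links of the
active tree do not carry. -/
theorem ne_active_of_path3 {x u v w : W} {n : ℕ} {i : Bool} {s : ℤ}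
    (hx : Q.placeOf x = some (n, i, s)) (h0 : s ≠ 0) (h1 : s ≠ 2 * n + 3) (hu : Q.graph.Adj x u)
    (hv : Q.Path3 x v) (hw : Q.graph.Adj x w) (hu' : ∃ p, Q.placeOf u = some p)
    (hw' : ∃ p, Q.placeOf w = some p) (huv : u ≠ v) (huw : u ≠ w) (hvw : v ≠ w) :
    i ≠ active n := by
  obtain ⟨k, y, r, hk, rfl, hr, hc, hn, hy⟩ := exists_pendant hx h0 h1 hu hv.1 hw hu' huv huw hvw
  obtain rfl := hy.resolve_right (by rintro rfl; rw [hn] at hw'; simp at hw')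
  obtain ⟨b, r', c, r'', hr', hr''⟩ := hv.exists_child hc
  exact ne_active_of_child hr hr' hr''

/-! The link above a vertex of type `tree i (n + 1)`. -/

/-- The types of the vertices of a link. -/
def linkType (i : Bool) (n : ℕ) : ℕ → State
  | 0 => tree i (n + 1)
  | k + 1 => if k ≤ 2 * n + 1 then link i n (2 * n + 1 - k) else tail i n

theorem child_linkType (i : Bool) (n k : ℕ) (h : k ≤ 2 * n + 2) :
    child moves (linkType i n k) (decide (k ≠ 0)) = some (linkType i n (k + 1)) := by
  cases k with
  | zero => simp [linkType, child]
  | succ k =>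
    rcases (show k ≤ 2 * n + 1 by omega).lt_or_eq with hk | rfl
    · rw [linkType, if_pos hk.le, linkType, if_pos (by omega),
        show 2 * n + 1 - k = (2 * n + 1 - (k + 1)) + 1 by omega]
      simp [child]
    · simp [linkType, child]

theorem exists_link (P : TypedTree V) {x : V} {i : Bool} {n : ℕ}
    (hx : P.type x = tree i (n + 1)) :
    ∃ z : ℕ → V, z 0 = x ∧ ∀ k, k ≤ 2 * n + 2 → P.par (z (k + 1)) = z k ∧
      P.type (z k) = linkType i n k ∧ P.label (z (k + 1)) = decide (k ≠ 0) ∧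
      P.type (z (k + 1)) = linkType i n (k + 1) := by
  classical
  -- The default `y` is never used for the indices up to the end of the link.
  let z : ℕ → V := Nat.rec x fun k y =>
    if h : ∃ y', P.par y' = y ∧ P.label y' = decide (k ≠ 0) ∧ P.type y' = linkType i n (k + 1)
    then h.choose else y
  have step : ∀ k, k ≤ 2 * n + 2 → P.type (z k) = linkType i n k → P.par (z (k + 1)) = z k ∧
      P.label (z (k + 1)) = decide (k ≠ 0) ∧ P.type (z (k + 1)) = linkType i n (k + 1) := by
    intro k hk ht
    have h := child_linkType i n k hk
    rw [← ht] at h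
    have h := P.exists_child_type h
    have hz : z (k + 1) = h.choose := dif_pos h
    rw [hz]
    exact h.choose_spec
  have type : ∀ k, k ≤ 2 * n + 2 → P.type (z k) = linkType i n k := by
    intro k
    induction k with
    | zero => exact fun _ => hx
    | succ k ih => exact fun hk => (step k (by omega) (ih (by omega))).2.2
  exact ⟨z, rfl, fun k hk => ⟨(step k hk (type k hk)).1, type k hk, (step k hk (type k hk)).2⟩⟩

theorem par_par_ne (P : TypedTree V) (x : V) : P.par (P.par x) ≠ x := fun h =>
  absurd (P.toParentTree.iterate_eq_iff (k := 2) (l := 0) (x := x) |>.1 h) (by norm_num)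

theorem adj_of_par {x y : V} (h : P.par y = x) : P.graph.Adj x y := .inr h

theorem path3_par (P : TypedTree V) (x : V) : P.Path3 x (P.par x) :=
  ⟨P.adj_par x, _, _, P.adj_par _, P.par_par_ne x, P.adj_par _, P.par_par_ne _⟩

theorem exists_path2 {x : V} {b c : Bool} {r r' : State} (h : child moves (P.type x) b = some r)
    (h' : child moves r c = some r') : ∃ u, P.par u = x ∧ P.label u = b ∧ P.Path2 x u := by
  obtain ⟨u, rfl, hl, rfl⟩ := P.exists_child_type h
  obtain ⟨v, rfl, -, rfl⟩ := P.exists_child_type h'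
  exact ⟨_, rfl, hl, adj_of_par rfl, v, adj_of_par rfl, (P.par_par_ne v).symm⟩

theorem exists_path3 {x : V} {b c d : Bool} {r r' r'' : State}
    (h : child moves (P.type x) b = some r) (h' : child moves r c = some r')
    (h'' : child moves r' d = some r'') : ∃ u, P.par u = x ∧ P.label u = b ∧ P.Path3 x u := by
  obtain ⟨u, rfl, hl, rfl⟩ := P.exists_child_type h
  obtain ⟨v, rfl, -, rfl⟩ := P.exists_child_type h'
  obtain ⟨w, rfl, -, rfl⟩ := P.exists_child_type h''
  exact ⟨_, rfl, hl, adj_of_par rfl, _, w, adj_of_par rfl, (P.par_par_ne _).symm, adj_of_par rfl,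
    (P.par_par_ne w).symm⟩

variable (f : SimpleGraph.Copy P.graph Q.graph)

theorem map_adj {x y : V} (h : P.graph.Adj x y) : Q.graph.Adj (f x) (f y) := f.toHom.map_adj h

theorem Path2.map {x u : V} (h : P.Path2 x u) : Q.Path2 (f x) (f u) := by
  obtain ⟨h1, v, h2, h3⟩ := h
  exact ⟨map_adj f h1, f v, map_adj f h2, f.injective.ne h3⟩

theorem Path3.map {x u : V} (h : P.Path3 x u) : Q.Path3 (f x) (f u) := by
  obtain ⟨h1, v, w, h2, h3, h4, h5⟩ := h
  exact ⟨map_adj f h1, f v, f w, map_adj f h2, f.injective.ne h3, map_adj f h4,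
    f.injective.ne h5⟩

theorem exists_placeOf_map {x u v w : V} (hu : P.graph.Adj x u) (hv : P.graph.Adj x v)
    (hw : P.graph.Adj x w) (huv : u ≠ v) (huw : u ≠ w) (hvw : v ≠ w) :
    ∃ p, Q.placeOf (f x) = some p :=
  exists_placeOf (map_adj f hu) (map_adj f hv) (map_adj f hw)
    (f.injective.ne huv) (f.injective.ne huw) (f.injective.ne hvw)

/-- A path all of whose vertices have positions runs along a link. -/
theorem exists_placeOf_eq {N : ℕ} {y : ℕ → W} (hN : 1 ≤ N)
    (hadj : ∀ k, k < N → Q.graph.Adj (y k) (y (k + 1)))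
    (hne : ∀ k, k + 1 < N → y k ≠ y (k + 2))
    (hp : ∀ k, k ≤ N → ∃ p, Q.placeOf (y k) = some p) :
    ∃ (m : ℕ) (j : Bool) (s ε : ℤ), (ε = 1 ∨ ε = -1) ∧
      ∀ k, k ≤ N → Q.placeOf (y k) = some (m, j, s + ε * k) := by
  have : ∀ k, ∃ p, k ≤ N → Q.placeOf (y k) = some p := by
    intro k
    by_cases h : k ≤ N
    · obtain ⟨p, hk⟩ := hp k h
      exact ⟨p, fun _ => hk⟩
    · exact ⟨(0, false, 0), fun h' => absurd h' h⟩
  choose p hp using this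
  have hadj' : ∀ k, k < N → (p (k + 1)).1 = (p k).1 ∧ (p (k + 1)).2.1 = (p k).2.1 ∧
      ((p (k + 1)).2.2 = (p k).2.2 + 1 ∨ (p (k + 1)).2.2 = (p k).2.2 - 1) := fun k hk =>
    placeOf_adj (hadj k hk) (hp k hk.le) (hp (k + 1) hk)
  have hne' : ∀ k, k + 1 < N → (p k).2.2 ≠ (p (k + 2)).2.2 := fun k hk =>
    placeOf_ne (hadj k (by omega)).symm (hadj (k + 1) hk) (hne k hk) (hp (k + 1) hk.le)
      (hp k (by omega)) (hp (k + 2) (by omega))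
  obtain ⟨ε, hε⟩ : ∃ ε, ε = (p 1).2.2 - (p 0).2.2 := ⟨_, rfl⟩
  have hε' : ε = 1 ∨ ε = -1 := by
    have := (hadj' 0 hN).2.2
    rw [zero_add] at this
    omega
  have key : ∀ k, k < N → (p k).1 = (p 0).1 ∧ (p k).2.1 = (p 0).2.1 ∧
      (p k).2.2 = (p 0).2.2 + ε * k ∧ (p (k + 1)).1 = (p 0).1 ∧ (p (k + 1)).2.1 = (p 0).2.1 ∧
      (p (k + 1)).2.2 = (p k).2.2 + ε := by
    intro k
    induction k with
    | zero =>
      intro hk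
      refine ⟨rfl, rfl, by simp, (hadj' 0 hk).1, (hadj' 0 hk).2.1, ?_⟩
      rw [hε]
      ring
    | succ k ih =>
      intro hk
      obtain ⟨-, -, h3, h4, h5, h6⟩ := ih (by omega)
      obtain ⟨g1, g2, g3⟩ := hadj' (k + 1) hk
      have g4 : (p k).2.2 ≠ (p (k + 1 + 1)).2.2 := hne' k hk
      refine ⟨h4, h5, ?_, g1.trans h4, g2.trans h5, ?_⟩
      · rw [h6, h3]
        push_cast
        ring
      · rcases hε' with rfl | rfl <;> omega
  refine ⟨(p 0).1, (p 0).2.1, (p 0).2.2, ε, hε', fun k hk => ?_⟩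
  rw [hp k hk]
  rcases hk.lt_or_eq with hk | rfl
  · obtain ⟨h1, h2, h3, -⟩ := key k hk
    rw [← h1, ← h2, ← h3]
  · obtain ⟨k, rfl⟩ : ∃ l, k = l + 1 := ⟨k - 1, by omega⟩
    obtain ⟨-, -, h3, h4, h5, h6⟩ := key k (by omega)
    rw [← h4, ← h5, show (p 0).2.2 + ε * ((k + 1 : ℕ) : ℤ) = (p (k + 1)).2.2 by
      rw [h6, h3]; push_cast; ring]

theorem exists_child_tail (i : Bool) (n : ℕ) (b : Bool) :
    ∃ q, child moves (tail i n) b = some (stem (stem q)) := by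
  cases b with
  | false => exact ⟨_, rfl⟩
  | true =>
    simp only [child, moves_apply, Option.map_some]
    split_ifs
    · exact ⟨_, rfl⟩
    · exact ⟨_, rfl⟩

theorem exists_child_link_false (i : Bool) (n k : ℕ) :
    ∃ q, child moves (link i n k) false = some q := by
  rw [child_link_false]
  split_ifs
  · exact ⟨_, rfl⟩
  · exact ⟨_, rfl⟩
  · exact ⟨_, rfl⟩

/-- Embeddings map links to links of the same level, preserving positions. -/
theorem placeOf_map {x : V} {i : Bool} {n : ℕ} (hx : P.type x = tree i (n + 1)) :
    ∃ j, Q.placeOf (f x) = some (n, j, bif i then 2 * (n : ℤ) + 3 else 0) ∧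
      (i ≠ active n → j = i) ∧
      ∃ y, P.par y = x ∧ P.label y = false ∧ ∃ p, Q.placeOf (f y) = some p := by
  obtain ⟨z, rfl, hz⟩ := P.exists_link hx
  have hadj : ∀ k, k < 2 * n + 3 → P.graph.Adj (z k) (z (k + 1)) := fun k hk =>
    adj_of_par (hz k (by omega)).1
  have hne : ∀ k, k + 1 < 2 * n + 3 → z k ≠ z (k + 2) := fun k hk h => by
    have h1 := (hz k (by omega)).1
    have h2 := (hz (k + 1) (by omega)).1
    rw [← h2, h] at h1
    exact P.par_par_ne _ h1
  have hlabel : ∀ k, k ≤ 2 * n + 2 → P.label (z (k + 1)) = decide (k ≠ 0) := fun k hk =>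
    (hz k hk).2.2.1
  have hlink : ∀ k, k ≤ 2 * n + 1 → P.type (z (k + 1)) = link i n (2 * n + 1 - k) := fun k hk => by
    rw [(hz k (by omega)).2.2.2, linkType, if_pos hk]
  have htail : P.type (z (2 * n + 3)) = tail i n := by
    rw [(hz (2 * n + 2) le_rfl).2.2.2, linkType, if_neg (by omega)]
  have hsib : ∀ u k, P.label u ≠ P.label (z (k + 1)) → z (k + 1) ≠ u := fun u k h h' => h (by rw [h'])
  obtain ⟨l, hl, hl', hl3⟩ : ∃ u, P.par u = z 0 ∧ P.label u = true ∧ P.Path3 (z 0) u :=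
    exists_path3 (c := true) (d := true) (by rw [hx]; rfl) rfl rfl
  have hzl : z 1 ≠ l := hsib l 0 (by rw [hl', hlabel 0 (by omega)]; simp)
  have hz1 : z 1 ≠ P.par (z 0) := fun h => by
    have := (hz 0 (by omega)).1
    rw [zero_add, h] at this
    exact P.par_par_ne _ this
  have hlp : l ≠ P.par (z 0) := fun h => by
    rw [h] at hl
    exact P.par_par_ne _ hl
  have hback : ∀ k u, k ≤ 2 * n + 2 → P.par u = z (k + 1) → z k ≠ u := fun k u hk hu h => by
    have := (hz k hk).1
    rw [← hu, h] at this
    exact P.par_par_ne _ this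
  have hend : ∀ b, ∃ u, P.par u = z (2 * n + 3) ∧ P.label u = b ∧ P.Path3 (z (2 * n + 3)) u := by
    intro b
    obtain ⟨q, hq⟩ := exists_child_tail i n b
    exact exists_path3 (c := true) (d := true) (htail ▸ hq) rfl rfl
  obtain ⟨u, hu, hu', hu3⟩ := hend true
  obtain ⟨v, hv, hv', hv3⟩ := hend false
  have huv : u ≠ v := fun h => by rw [h, hv'] at hu'; simp at hu'
  have hzu : z (2 * n + 2) ≠ u := hback _ _ le_rfl hu
  have hzv : z (2 * n + 2) ≠ v := hback _ _ le_rfl hv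
  -- All vertices from `z 0` to `z (2 * n + 3)` have degree three, and this is inherited by their
  -- images.
  have hp : ∀ k, k ≤ 2 * n + 3 → ∃ p, Q.placeOf (f (z k)) = some p := by
    intro k hk
    cases k with
    | zero => exact exists_placeOf_map f (hadj 0 (by omega)) hl3.1 (P.adj_par _) hzl hz1 hlp
    | succ k =>
      rcases hk.lt_or_eq with hk | hk
      · obtain ⟨q, hq⟩ := exists_child_link_false i n (2 * n + 1 - k)
        rw [← hlink k (by omega)] at hq
        obtain ⟨w, hw, hw'⟩ := P.exists_child _ _ _ hq
        refine exists_placeOf_map f (hadj k (by omega)).symm (hadj (k + 1) hk) (adj_of_par hw)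
          (hne k hk) (hback _ _ (by omega) hw) (hsib _ _ ?_)
        rw [hw', hlabel (k + 1) (by omega)]
        simp
      · obtain rfl : k = 2 * n + 2 := by omega
        exact exists_placeOf_map f (hadj _ (by omega)).symm hu3.1 hv3.1 hzu hzv huv
  obtain ⟨m, j, s, ε, hε, hpl⟩ := exists_placeOf_eq (y := fun k => f (z k)) (by omega)
    (fun k hk => map_adj f (hadj k hk)) (fun k hk => f.injective.ne (hne k hk)) hp
  -- An end of the link has two neighbours off the link, each starting a longer path; an inner
  -- vertex of the target link allows this only at place `1`.
  have h0 : s = 0 ∨ s = 2 * m + 3 ∨ s = 1 := by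
    by_contra! h
    have := hpl 0 (by omega)
    simp only [Nat.cast_zero, mul_zero, add_zero] at this
    exact h.2.2 (placeOf_eq_one_of_path2 this h.1 h.2.1 (map_adj f (hadj 0 (by omega)))
      (hl3.path2.map f) ((P.path3_par _).path2.map f) (hp 1 (by omega)) (f.injective.ne hzl)
      (f.injective.ne hz1) (f.injective.ne hlp))
  have h1 : s + ε * (2 * n + 3) = 0 ∨ s + ε * (2 * n + 3) = 2 * m + 3 ∨
      s + ε * (2 * n + 3) = 1 := by
    by_contra! h
    have := hpl (2 * n + 3) le_rfl
    push_cast at this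
    exact h.2.2 (placeOf_eq_one_of_path2 this h.1 h.2.1
      (map_adj f (hadj (2 * n + 2) (by omega)).symm)
      (hu3.path2.map f) (hv3.path2.map f) (hp (2 * n + 2) (by omega)) (f.injective.ne hzu)
      (f.injective.ne hzv) (f.injective.ne huv))
  -- The two end places differ by `2n + 3`, which is odd and at least `3`. The differences between
  -- `0`, `1` and `2m + 3` are `1`, `2m + 2` and `2m + 3`, so only the last one fits.
  have h2 : m = n ∧ (s = 0 ∧ ε = 1 ∨ s = 2 * n + 3 ∧ ε = -1) := by
    rcases hε with rfl | rfl <;> omega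
  obtain ⟨rfl, h2⟩ := h2
  -- The vertex `z (k + 1)` carries the distinguished pendant. Its image must lie at place `1`,
  -- which fixes the orientation, and a long pendant also fixes the index of the tree.
  obtain ⟨k, hk, hk'⟩ : ∃ k : ℕ, k ≤ 2 * m + 1 ∧ 2 * m + 1 - k = bif i then 0 else 2 * m + 1 := by
    cases i
    · exact ⟨0, by omega, rfl⟩
    · exact ⟨2 * m + 1, le_rfl, by simp⟩
  have hs0 : s + ε * ((k + 1 : ℕ) : ℤ) ≠ 0 := by
    rcases h2 with ⟨rfl, rfl⟩ | ⟨rfl, rfl⟩ <;> push_cast <;> omega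
  have hs1 : s + ε * ((k + 1 : ℕ) : ℤ) ≠ 2 * m + 3 := by
    rcases h2 with ⟨rfl, rfl⟩ | ⟨rfl, rfl⟩ <;> push_cast <;> omega
  have hzz : ∀ w, P.par w = z (k + 1) → P.label w = false → z (k + 2) ≠ w := fun w hw hw' => by
    refine hsib _ _ ?_
    rw [hw', hlabel (k + 1) (by omega)]
    simp
  refine ⟨j, ?_, fun hi => ?_, z 1, (hz 0 (by omega)).1, hlabel 0 (by omega), hp 1 (by omega)⟩
  · obtain ⟨w, hw, hw', hw2⟩ : ∃ w, P.par w = z (k + 1) ∧ P.label w = false ∧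
        P.Path2 (z (k + 1)) w := by
      have hc := child_link_false i m (2 * m + 1 - k)
      rw [← hlink k hk, if_pos hk'] at hc
      split_ifs at hc
      · exact exists_path2 (c := true) hc rfl
      · exact exists_path2 (c := true) hc rfl
    have := placeOf_eq_one (hpl (k + 1) (by omega)) hs0 hs1
      (map_adj f (hadj k (by omega)).symm) (hw2.map f)
      (map_adj f (hadj (k + 1) (by omega))) (hp k (by omega)) (hp (k + 2) (by omega))
      (f.injective.ne (hback _ _ (by omega) hw)) (f.injective.ne (hne k (by omega)))
      (f.injective.ne (hzz w hw hw').symm)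
    have h := hpl 0 (by omega)
    simp only [Nat.cast_zero, mul_zero, add_zero] at h
    rw [h]
    congr 3
    cases i <;> simp only [cond_true, cond_false] at hk' ⊢ <;>
      rcases h2 with ⟨rfl, rfl⟩ | ⟨rfl, rfl⟩ <;> push_cast at this <;> omega
  · obtain ⟨w, hw, hw', hw3⟩ : ∃ w, P.par w = z (k + 1) ∧ P.label w = false ∧
        P.Path3 (z (k + 1)) w := by
      have hc := child_link_false i m (2 * m + 1 - k)
      rw [← hlink k hk, if_pos hk', if_neg hi] at hc
      exact exists_path3 (c := true) (d := true) hc rfl rfl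
    have := ne_active_of_path3 (hpl (k + 1) (by omega)) hs0 hs1
      (map_adj f (hadj k (by omega)).symm) (hw3.map f)
      (map_adj f (hadj (k + 1) (by omega))) (hp k (by omega)) (hp (k + 2) (by omega))
      (f.injective.ne (hback _ _ (by omega) hw)) (f.injective.ne (hne k (by omega)))
      (f.injective.ne (hzz w hw hw').symm)
    revert hi this
    cases i <;> cases j <;> cases active m <;> simp

/-! ### Embeddings that respect parents, and counting descendants -/

/-- Embeddings do not backtrack. -/
theorem par_map {x y z : V} (h : Q.par (f y) = f x) (hy : P.graph.Adj y z) (hz : z ≠ x) :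
    Q.par (f z) = f y :=
  (Q.par_eq_or_of_adj (map_adj f hy)).resolve_left fun h' =>
    hz (f.injective (h'.trans h))

theorem par_map_of_par {x : V} (h : Q.par (f (P.par x)) = f (P.par (P.par x))) :
    Q.par (f x) = f (P.par x) :=
  par_map f h (adj_of_par rfl) (P.par_par_ne x).symm

/-- Once the edge above `x` is mapped upwards, injectivity prevents any lower edge from turning
back, so descendants keep their depth. -/
theorem iterate_par_map {x : V} (h : Q.par (f x) = f (P.par x)) {L : ℕ} {y : V}
    (hy : P.par^[L] y = x) : Q.par (f y) = f (P.par y) ∧ Q.par^[L] (f y) = f x := by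
  induction L generalizing y with
  | zero => obtain rfl := hy; exact ⟨h, rfl⟩
  | succ L ih =>
    obtain ⟨h1, h2⟩ := ih (y := P.par y) hy
    have h3 : Q.par (f y) = f (P.par y) := par_map_of_par (x := y) f h1
    exact ⟨h3, by rw [Function.iterate_succ_apply, h3, h2]⟩

/-- The labels on the path to the `L`-th ancestor. -/
def word (P : TypedTree V) : ℕ → V → List Bool
  | 0, _ => []
  | L + 1, x => word P L (P.par x) ++ [P.label x]

theorem length_word (P : TypedTree V) (L : ℕ) (x : V) : (P.word L x).length = L := by
  induction L generalizing x with
  | zero => rfl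
  | succ L ih => simp [word, ih]

theorem run_word (P : TypedTree V) (L : ℕ) (x : V) :
    run moves (P.type (P.par^[L] x)) (P.word L x) = some (P.type x) := by
  induction L generalizing x with
  | zero => rfl
  | succ L ih =>
    rw [word, run_append, Function.iterate_succ_apply, ih, Option.bind_some, run_cons,
      P.child_par]
    rfl

theorem word_injOn (P : TypedTree V) (L : ℕ) (x : V) :
    Set.InjOn (P.word L) {y | P.par^[L] y = x} := by
  induction L with
  | zero => intro y hy z hz _; exact hy.trans hz.symm
  | succ L ih =>
    intro y hy z hz h
    have h' := List.append_inj h (by rw [length_word, length_word])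
    have h1 := ih (x₁ := P.par y) (x₂ := P.par z) hy hz h'.1
    exact P.eq_of_label y z h1 (by simpa using h'.2)

theorem exists_word_eq (P : TypedTree V) {x : V} {w : List Bool} (hw : w ∈ lang (P.type x)) :
    ∃ y, P.par^[w.length] y = x ∧ P.word w.length y = w := by
  induction w using List.reverseRecOn with
  | nil => exact ⟨x, rfl, rfl⟩
  | append_singleton w b ih =>
    obtain ⟨y, rfl, hy⟩ := ih (by simpa using dropClosed_lang _ _ hw)
    have hr := P.run_word w.length y
    rw [hy] at hr
    rw [mem_lang, run_append, hr, Option.bind_some, run_cons] at hw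
    obtain ⟨q, hq⟩ := Option.isSome_iff_exists.1 (Option.isSome_of_isSome_bind hw)
    obtain ⟨z, rfl, rfl, -⟩ := P.exists_child_type hq
    rw [List.length_append, List.length_singleton]
    exact ⟨z, rfl, by rw [word, hy]⟩

theorem finite_lang_length (q : State) (L : ℕ) : {w | w ∈ lang q ∧ w.length = L}.Finite :=
  (List.finite_length_eq Bool L).subset fun _ h => h.2

/-- If an embedding preserves the parent of `x`, then the language of `x` is at most as large as
the language of its image. -/
theorem ncard_le_ncard_map {x : V} (h : Q.par (f x) = f (P.par x)) (L : ℕ) :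
    {w | w ∈ lang (P.type x) ∧ w.length = L}.ncard ≤
      {w | w ∈ lang (Q.type (f x)) ∧ w.length = L}.ncard := by
  have : ∀ w, ∃ y, w ∈ lang (P.type x) ∧ w.length = L → P.par^[L] y = x ∧ P.word L y = w := by
    intro w
    by_cases hw : w ∈ lang (P.type x) ∧ w.length = L
    · obtain ⟨hw, rfl⟩ := hw
      exact (P.exists_word_eq hw).imp fun y hy _ => hy
    · exact ⟨x, fun h => absurd h hw⟩
  choose g hg using this
  refine Set.ncard_le_ncard_of_injOn (fun w => Q.word L (f (g w))) (fun w hw => ?_)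
    (fun w hw v hv hwv => ?_) (finite_lang_length _ L)
  · have h1 := (iterate_par_map f h (hg w hw).1).2
    have h2 := Q.run_word L (f (g w))
    rw [h1] at h2
    exact ⟨by rw [mem_lang, h2]; rfl, Q.length_word _ _⟩
  · have h1 := (iterate_par_map f h (hg w hw).1).2
    have h2 := (iterate_par_map f h (hg v hv).1).2
    have h3 := f.injective (Q.word_injOn L (f x) h1 h2 hwv)
    rw [← (hg w hw).2, ← (hg v hv).2, h3]

/-- At depth `(addr n).length` there are finitely many descendants, and cutting removes at least the
one at `addr n`. An injection preserving depth is impossible. -/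
theorem not_cutting_addr {x : V} {n : ℕ} (hx : P.type x = tree (active n) n)
    (h : Q.par (f x) = f (P.par x)) :
    ¬ Cutting (Q.type (f x)) (cut (tree (active n) n) (addr n)) := by
  intro hc
  refine (ncard_le_ncard_map f h (addr n).length).not_gt (Set.ncard_lt_ncard ?_
    (finite_lang_length _ _))
  have hs := hc.lang_subset
  rw [lang_cut _ (addr_ne_nil n), ← hx] at hs
  refine ⟨fun w hw => ⟨(hs hw.1).1, hw.2⟩, fun hsub => ?_⟩
  have := hsub (a := addr n) ⟨by rw [hx, mem_lang, run_addr]; rfl, rfl⟩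
  exact (hs this.1).2 (List.prefix_refl _)

theorem cutting_of_stem (Q : TypedTree W) {x : W} {r : State}
    (h : Cutting (Q.type (Q.par x)) (stem r)) : Q.label x = true ∧ Cutting (Q.type x) r := by
  obtain ⟨q, hq, hc⟩ := Q.exists_core_child h
  cases hl : Q.label x with
  | false => rw [hl] at hq; simp [child] at hq
  | true =>
    rw [hl] at hq
    obtain rfl := Option.some.inj hq
    exact ⟨rfl, hc⟩

/-- Having turned downwards, the image must run through both stems and reach a vertex of type `tree
j n` at the third ancestor. That type has no place or one of level below `n`, whereas level `n + 1`
is required. -/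
theorem not_par_map_par {x : V} {i j : Bool} {n : ℕ} {r : State}
    (hx : P.type (P.par (P.par (P.par x))) = tree i (n + 1 + 1))
    (h : Q.par (f (P.par x)) = f x) (hc : Cutting (Q.type (f (P.par x))) (stem (stem r))) :
    core r ≠ tree j n := by
  intro hr
  have h1 := par_map f h (P.adj_par _) (P.par_par_ne x)
  have h2 := par_map f h1 (P.adj_par _) (P.par_par_ne _)
  rw [← h1] at hc
  have hc := (Q.cutting_of_stem hc).2
  rw [← h2] at hc
  have hc := (Q.cutting_of_stem hc).2
  obtain ⟨k, hk, -⟩ := placeOf_map f hx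
  rw [placeOf, hc.core_eq, hr] at hk
  cases n with
  | zero => simp [place] at hk
  | succ n =>
    simp only [place, Option.some.injEq, Prod.mk.injEq] at hk
    omega

/-- The position leaves only the far end of a link of index `!active n` as an alternative. There the
branch towards the cut copy has to be the image of some branch at `x`, and none fits. -/
theorem core_type_map {x : V} {i : Bool} {n : ℕ} (hx : P.type x = tree i (n + 1))
    (hx' : P.type (P.par (P.par (P.par x))) = tree i (n + 1 + 1)) :
    core (Q.type (f x)) = tree i (n + 1) ∨ core (Q.type (f x)) = cone i n := by
  obtain ⟨j, hj, ha, z, hz, hz', hp⟩ := placeOf_map f hx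
  by_cases hji : j = i
  · subst hji
    exact eq_tree_or_cone_of_place (Q.valid _).core hj
  exfalso
  obtain rfl : i = active n := by_contra fun h => hji (ha h)
  obtain rfl : j = !active n := by
    revert hji
    cases j <;> cases active n <;> simp
  have ht := eq_tail_of_place hj
  obtain ⟨l, hl, hl', hlt⟩ := P.exists_child_type (x := x) (b := true)
    (q := stem (stem (tree (active n) n))) (by rw [hx]; rfl)
  obtain ⟨m, hm, -, hmt⟩ := P.exists_child_type (x := l) (b := true)
    (q := stem (tree (active n) n)) (by rw [hlt]; rfl)
  obtain ⟨k, hk, -, hkt⟩ := P.exists_child_type (x := m) (b := true)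
    (q := tree (active n) n) (by rw [hmt]; rfl)
  have hzl : z ≠ l := fun h => by rw [h, hl'] at hz'; simp at hz'
  have hne : ∀ u, P.par u = x → u ≠ P.par x := fun u hu h => by
    rw [h] at hu
    exact P.par_par_ne _ hu
  obtain ⟨y, hy, hyl, hyu⟩ := Q.exists_child_of_adj (map_adj f (adj_of_par hz))
    (map_adj f (adj_of_par hl)) (map_adj f (P.adj_par x)) (f.injective.ne hzl)
    (f.injective.ne (hne z hz)) (f.injective.ne (hne l hl)) true
  have hc := cutting_core (Q.type (f x))
  rw [ht, ← hy] at hc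
  obtain ⟨r, hr, hc⟩ := Q.exists_core_child hc
  have hr' : r = stem (stem (cut (tree (active n) n) (addr n))) := by
    rw [hyl] at hr
    simpa [child, moves_apply, eq_comm] using hr
  rw [hr'] at hc
  -- The link cannot enter the cut branch, since its next vertex needs a place; the lower tree
  -- cannot by counting; the upward branch cannot because of the level of the next link.
  rcases hyu with rfl | rfl | rfl
  · obtain ⟨p, hp⟩ := hp
    change place (core (Q.type (f z))) = some p at hp
    rw [hc.core_eq] at hp
    simp [core, place] at hp
  · rw [← hl] at hy
    have h1 := par_map f hy (adj_of_par hm) fun h => P.par_par_ne m (by rw [hm, ← h])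
    rw [← hm] at h1
    have h2 := par_map f h1 (adj_of_par hk) fun h => P.par_par_ne k (by rw [hk, ← h])
    subst hm hk
    change Cutting (Q.type (f _)) _ at hc
    rw [← h1] at hc
    have hc := (Q.cutting_of_stem hc).2
    rw [← h2] at hc
    exact not_cutting_addr f hkt h2 (Q.cutting_of_stem hc).2
  · exact not_par_map_par f hx' hy hc rfl

/-- Of the branches at the image of `x`, one is taken by the link and the lower one has links of too
small a level, so the parent is mapped to the parent. Above a `tree` come two stems with no other
branch, and then a vertex that cannot be a cone. -/
theorem core_type_map_succ {x : V} {i : Bool} {n : ℕ} (hx : P.type x = tree i (n + 1))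
    (hx1 : P.type (P.par (P.par (P.par x))) = tree i (n + 1 + 1))
    (hx2 : core (Q.type (f (P.par (P.par (P.par x))))) = tree i (n + 1 + 1) ∨
      core (Q.type (f (P.par (P.par (P.par x))))) = cone i (n + 1))
    (hf : core (Q.type (f x)) = tree i (n + 1)) :
    f (P.par (P.par (P.par x))) = Q.par (Q.par (Q.par (f x))) ∧
      core (Q.type (f (P.par (P.par (P.par x))))) = tree i (n + 1 + 1) := by
  obtain ⟨-, -, -, z, hz, -, p, hp⟩ := placeOf_map f hx
  have hstem : ∀ {y : W}, core (Q.type y) = tree i (n + 1) →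
      ∃ q, core (Q.type (Q.par y)) = stem q ∧ core q = tree i (n + 1) := by
    intro y hy
    obtain ⟨r, hr, hc⟩ := Q.exists_core_child (x := y) (cutting_core _)
    exact eq_stem_of_child_tree hr (hc.core_eq ▸ hy)
  obtain ⟨q, hq, hq'⟩ := hstem hf
  have hfz : Q.par (f z) = f x := by
    refine (Q.par_eq_or_of_adj (map_adj f (adj_of_par hz))).resolve_left fun h => ?_
    rw [placeOf, h, hq] at hp
    simp [place] at hp
  have hfl : Q.label (f z) = false := by
    obtain ⟨j, hj, -⟩ := placeOf_map f hx
    rw [← hfz] at hj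
    rw [(placeOf_par hj hp).2.2.2, hfz, hf]
    rfl
  have h1 : Q.par (f x) = f (P.par x) := by
    refine ((Q.par_eq_or_of_adj (map_adj f (P.adj_par x))).resolve_right fun h => ?_).symm
    have hc := cutting_core (Q.type (f x))
    rw [hf, ← h] at hc
    obtain ⟨r, hr, hc⟩ := Q.exists_core_child hc
    cases hl : Q.label (f (P.par x)) with
    | true =>
      rw [hl] at hr
      obtain rfl := Option.some.inj hr
      exact not_par_map_par f hx1 h hc rfl
    | false =>
      have := f.injective (Q.eq_of_label _ _ (hfz.trans h.symm) (hfl.trans hl.symm))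
      rw [this] at hz
      exact P.par_par_ne _ hz
  have hup : ∀ {y : V} {q : State}, Q.par (f y) = f (P.par y) →
      core (Q.type (f (P.par y))) = stem q → Q.par (f (P.par y)) = f (P.par (P.par y)) := by
    intro y q h hq
    refine ((Q.par_eq_or_of_adj (map_adj f (P.adj_par _))).resolve_right fun h' => ?_).symm
    have hc := cutting_core (Q.type (f (P.par y)))
    rw [hq] at hc
    have l1 := (Q.cutting_of_stem (x := f y) (h.symm ▸ hc)).1
    have l2 := (Q.cutting_of_stem (x := f (P.par (P.par y))) (h'.symm ▸ hc)).1
    exact P.par_par_ne y (f.injective (Q.eq_of_label _ _ (h'.trans h.symm) (l2.trans l1.symm)))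
  rw [h1] at hq
  have h2 := hup h1 hq
  obtain ⟨r, hr, hc⟩ := Q.exists_core_child (x := f (P.par x)) (cutting_core _)
  obtain ⟨q2, hq2, hq2'⟩ := eq_stem_of_child_stem_tree hr (hc.core_eq ▸ hq) hq'
  rw [h2] at hq2
  have h3 := hup h2 hq2
  refine ⟨by rw [h1, h2, h3], hx2.resolve_right fun h => ?_⟩
  obtain ⟨r, hr, hc⟩ := Q.exists_core_child (x := f (P.par (P.par x))) (cutting_core _)
  rw [h3, h] at hr
  exact cone_child_ne hr (hc.core_eq ▸ hq2) hq2' hq'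

end TypedTree

/-! ### Neither tree embeds into the other -/

theorem type_iterate_origin_three_mul (i : Bool) (n : ℕ) :
    (typedTree i).type ((typedTree i).par^[3 * n] (origin i)) = tree i n := by
  rw [type_iterate_origin, spine_three_mul]

theorem not_isContained (i : Bool) : ¬ (graphOf i).IsContained (graphOf (!i)) := by
  rintro ⟨f⟩
  let x : ℕ → Vertex i := fun n => (typedTree i).par^[3 * (n + 1)] (origin i)
  have hx : ∀ n, (typedTree i).type (x n) = tree i (n + 1) := fun n =>
    type_iterate_origin_three_mul i (n + 1)
  have hs : ∀ n, x (n + 1) = (typedTree i).par ((typedTree i).par ((typedTree i).par (x n))) := by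
    exact fun n => (congrArg (fun k => (typedTree i).par^[k] (origin i)) (by ring)).trans
      (Function.iterate_add_apply _ 3 (3 * (n + 1)) _)
  have hx' : ∀ n, (typedTree i).type ((typedTree i).par ((typedTree i).par
      ((typedTree i).par (x n)))) = tree i (n + 1 + 1) := fun n => by rw [← hs, hx]
  have hB := fun n => TypedTree.core_type_map f (hx n) (hx' n)
  have key : ∀ n, f (x n) = (typedTree (!i)).par^[3 * n] (f (x 0)) ∧
      core ((typedTree (!i)).type (f (x n))) = tree i (n + 1) := by
    intro n
    induction n with
    | zero =>
      -- At the bottom level the alternative would be `cone i 0`, which occurs in neither tree.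
      refine ⟨rfl, (hB 0).resolve_right fun h => ?_⟩
      have := ((typedTree (!i)).valid (f (x 0))).core
      rw [h] at this
      exact this rfl
    | succ n ih =>
      have h := TypedTree.core_type_map_succ f (hx n) (hx' n) (by rw [← hs]; exact hB (n + 1)) ih.2
      rw [← hs] at h
      refine ⟨?_, h.2⟩
      rw [h.1, ih.1, mul_add, add_comm]
      exact (Function.iterate_add_apply _ 3 (3 * n) _).symm
  -- Sufficiently high ancestors of `f (x 0)` lie on the spine of the tree `!i`, where no type has
  -- core `tree i _`.
  obtain ⟨K, hK⟩ := exists_type_spine (f (x 0))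
  obtain ⟨l, hl⟩ := hK (3 * K) (by omega)
  have h := (key K).2
  rw [(key K).1, hl] at h
  obtain ⟨m, rfl | rfl | rfl⟩ := eq_three_mul_add l
  · rw [spine_three_mul] at h
    simp [core] at h
  · rw [spine_three_mul_add_one] at h
    simp [core] at h
  · rw [spine_three_mul_add_two] at h
    simp [core] at h

/-! ### Degrees, infinitude and the final assembly -/

theorem hasMaxDegree (i : Bool) : HasMaxDegree (graphOf i) 3 := by
  refine ⟨(typedTree i).encard_neighborSet_le, (typedTree i).par^[3] (origin i),
    ((typedTree i).encard_neighborSet_le _).antisymm ?_⟩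
  have hx := type_iterate_origin_three_mul i 1
  set x := (typedTree i).par^[3 * 1] (origin i)
  obtain ⟨u, hu, hu', -⟩ := (typedTree i).exists_child_type (x := x) (b := true)
    (q := stem (stem (tree i 0))) (by rw [hx]; rfl)
  obtain ⟨v, hv, hv', -⟩ := (typedTree i).exists_child_type (x := x) (b := false)
    (q := link i 0 1) (by rw [hx]; rfl)
  have huv : u ≠ v := fun h => by rw [h, hv'] at hu'; simp at hu'
  have hne : ∀ w, (typedTree i).par w = x → w ≠ (typedTree i).par x := fun w hw h => by
    rw [h] at hw
    exact (typedTree i).par_par_ne _ hw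
  have h3 : ({u, v, (typedTree i).par x} : Set (Vertex i)).encard = 3 := by
    rw [Set.encard_eq_three]
    exact ⟨u, v, _, huv, hne u hu, hne v hv, rfl⟩
  change (3 : ℕ∞) ≤ ((graphOf i).neighborSet x).encard
  rw [← h3]
  refine Set.encard_le_encard ?_
  rintro w (rfl | rfl | rfl)
  · exact .inr hu
  · exact .inr hv
  · exact .inl rfl

instance (i : Bool) : Nonempty (Vertex i) := ⟨origin i⟩

instance (i : Bool) : Infinite (Vertex i) := (typedTree i).infinite

theorem isLocallyFinite_graphOf (i : Bool) : IsLocallyFinite (graphOf i) := fun x =>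
  Set.finite_of_encard_le_coe ((typedTree i).encard_neighborSet_le x)

theorem infinite_edgeSet (i : Bool) : (graphOf i).edgeSet.Infinite :=
  Set.infinite_coe_iff.1 <|
    Infinite.of_injective (typedTree i).parEdge (typedTree i).parEdge_bijective.1

theorem isEmpty_iso : IsEmpty (graphOf false ≃g graphOf true) :=
  ⟨fun e => not_isContained false ⟨e.toCopy⟩⟩

theorem IsEdgeHypomorphism.symm {V W : Type*} {G : SimpleGraph V} {H : SimpleGraph W}
    {ψ : G.edgeSet ≃ H.edgeSet} (h : IsEdgeHypomorphism G H ψ) :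
    IsEdgeHypomorphism H G ψ.symm := fun e => by
  have := h (ψ.symm e)
  rw [Equiv.apply_symm_apply] at this
  exact this.map SimpleGraph.Iso.symm

theorem mainTheorem2 :
    ∃ (V W : Type) (T : SimpleGraph V) (S : SimpleGraph W)
      (φ : V ≃ W) (ψ : T.edgeSet ≃ S.edgeSet)
      (ET : RootedExhaustion T) (ES : RootedExhaustion S)
      (eT : V → T.edgeSet) (eS : W → S.edgeSet),
      -- infinite trees of maximum degree three, neither of which embeds into the other
      (Infinite V ∧ Infinite W ∧ T.IsTree ∧ S.IsTree ∧ HasMaxDegree T 3 ∧ HasMaxDegree S 3 ∧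
        ¬ T.IsContained S ∧ ¬ S.IsContained T) ∧
      -- they are vertex-hypomorphic via `φ`
      IsHypomorphism T S φ ∧
      -- `eT x` and `eS y` are the first edges on the paths to the root
      (ET.IsFirstEdgeMap eT ∧ ES.IsFirstEdgeMap eS ∧
        Function.Bijective eT ∧ Function.Bijective eS) ∧
      -- they are edge-hypomorphic via `ψ : e(x) ↦ e(φ(x))`
      (∀ x, ψ (eT x) = eS (φ x)) ∧
      IsEdgeHypomorphism T S ψ ∧
      -- indeed, some isomorphism `T - x ≅ S - φ(x)`, extended by `x ↦ φ(x)`, is an isomorphism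
      -- `T - e(x) ≅ S - e(φ(x))`
      (∀ x, ∃ (h : T.induce {y | y ≠ x} ≃g S.induce {z | z ≠ φ x})
          (g : T.deleteEdges {(eT x).1} ≃g S.deleteEdges {(eS (φ x)).1}),
          g x = φ x ∧ ∀ (y : V) (hy : y ≠ x), g y = (h ⟨y, hy⟩).1) ∧
      -- they are locally finite with infinitely many edges, non-isomorphic, and hence not
      -- edge-reconstructible
      (IsLocallyFinite T ∧ IsLocallyFinite S ∧ T.edgeSet.Infinite ∧ S.edgeSet.Infinite ∧
        IsEmpty (T ≃g S) ∧ ¬ EdgeReconstructible T ∧ ¬ EdgeReconstructible S) := by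
  obtain ⟨φ, hφ⟩ := exists_hypomorphism
  let εT := Equiv.ofBijective _ (typedTree false).parEdge_bijective
  let εS := Equiv.ofBijective _ (typedTree true).parEdge_bijective
  let ψ : (graphOf false).edgeSet ≃ (graphOf true).edgeSet := (εT.symm.trans φ).trans εS
  have hψ : ∀ x, ψ ((typedTree false).parEdge x) = (typedTree true).parEdge (φ x) := fun x =>
    congrArg (fun z => εS (φ z)) (εT.symm_apply_apply x)
  have hE : IsEdgeHypomorphism (graphOf false) (graphOf true) ψ := fun e => by
    obtain ⟨x, rfl⟩ := (typedTree false).parEdge_bijective.2 e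
    obtain ⟨g, -⟩ := hφ x
    rw [hψ]
    exact ⟨g⟩
  refine ⟨Vertex false, Vertex true, graphOf false, graphOf true, φ, ψ,
    (typedTree false).exhaustion (origin false), (typedTree true).exhaustion (origin true),
    (typedTree false).parEdge, (typedTree true).parEdge,
    ⟨inferInstance, inferInstance, (typedTree false).isTree, (typedTree true).isTree,
      hasMaxDegree _, hasMaxDegree _, not_isContained false, not_isContained true⟩,
    fun x => ?_,
    ⟨(typedTree false).isFirstEdgeMap _, (typedTree true).isFirstEdgeMap _,
      (typedTree false).parEdge_bijective, (typedTree true).parEdge_bijective⟩,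
    hψ, hE, fun x => ?_,
    isLocallyFinite_graphOf _, isLocallyFinite_graphOf _, infinite_edgeSet _, infinite_edgeSet _,
    isEmpty_iso, fun h => ?_, fun h => ?_⟩
  · obtain ⟨g, hg⟩ := hφ x
    obtain ⟨h, -⟩ := ParentTree.exists_induce_iso g hg
    exact ⟨h⟩
  · obtain ⟨g, hg⟩ := hφ x
    obtain ⟨h, hh⟩ := ParentTree.exists_induce_iso g hg
    exact ⟨h, g, hg, hh⟩
  · obtain ⟨e⟩ := h _ _ ⟨ψ, hE⟩
    exact isEmpty_iso.false e.symm
  · obtain ⟨e⟩ := h _ _ ⟨ψ.symm, hE.symm⟩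
    exact isEmpty_iso.false e
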